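/- **Nets.** A multi reversing Petri net consists of finite sets $P$ of places, $T$ of transitions, $A$ of token types and $A_V$ of variables, each $v\in A_V$ with a type in $A$; a set $B$ of undirected bond types; and arc labels $F(x,t),F(t,x)\subseteq A_V\cup(A_V\times A_V)$ for $x\in P$, $t\in T$, where pairs are undirected bonds, have bond types in $B$, and $(u,v)\in F(\cdot,\cdot)$ implies that $u,v$ lie in the same label. Put $\mathrm{guard}(t)=\bigcup_xF(x,t)$, $\mathrm{effects}(t)=\bigcup_xF(t,x)$. The net is well-formed: $\mathrm{guard}(t)\cap A_V=\mathrm{effects}(t)\cap A_V$, and no variable lies in both $F(t,x)$ and $F(t,y)$ for $x\ne y$. Token instances are $(a,*,i)$ ($a\in A$, $i\in\mathbb N$) and, recursively, $(\alpha,k,u)$ with $\alpha$ a token instance, $k\in\mathbb N$, $u\in A_V\cup\{*\}$; write $\alpha\mathrel{\overline\in}\beta$ if $\beta$ is $\alpha$ with zero or more further memories. A state $\langle M,H\rangle$ consists of a marking $M$ (a set of token instances and undirected bonds between them in each place) and a history $H:T\to2^{\mathbb N}$. Initially $H_0(t)=\emptyset$ for all $t$, tokens in $M_0$ are of the form $(a,*,i)$,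 each in at most one place, and each bond in $M_0(x)$ has a type in $B$ and joins tokens of $M_0(x)$. Let $\mathrm{con}(\alpha,C)$ be the set of the tokens connected to $\alpha$ by bonds in $C$ together with these bonds, $\mathrm{pre}(t,U)=U(\mathrm{guard}(t))$, $\mathrm{post}(t,U)=U(\mathrm{effects}(t))$. All assignments $U$ below are injective and type-preserving from the variables of $t$ to token instances. **Forward.** $t$ fires via $U$ if $U(F(x,t))\subseteq M(x)$ for all $x$; for variables $u,v\in F(x,t)$, $(U(u),U(v))\in M(x)$ implies $(u,v)\in F(x,t)$; and for $u\in F(t,y_1)$, $v\in F(t,y_2)$, $y_1\ne y_2$ and every $x$ with $F(x,t)\neq\emptyset$, $U(u)\notin\mathrm{con}(U(v),(M(x)\setminus\mathrm{pre}(t,U))\cup\mathrm{post}(t,U))$. With $k=1+\max(\{0\}\cup\bigcup_{t'}H(t'))$, firing removes $\bigcup_{u\in F(x,t)}\mathrm{con}(U(u),M(x))$ from each place $x$ and then adds to it $\bigcup_{u\in F(t,x),\,U(u)\in M(y)}\mathrm{con}(U(u),(M(y)\setminus\mathrm{pre}(t,U))\cup\mathrm{post}(t,U))$, where every token $\alpha$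 is replaced by $(\alpha,k,u)$ if $\alpha=U(u)$ and by $(\alpha,k,*)$ if $\alpha$ is not in the image of $U$; and $k$ is added to $H(t)$. **Backtracking and causal reversal.** Let $k\in H(t)$. $(t,k)$ is bt-enabled (respectively c-enabled) if $k$ is the largest key in $H$ (respectively there are no $t'$, $k'\in H(t')$ with $k'>k$ such that some token in $M$ has memories with both keys $k$ and $k'$) and there is $U$ such that, for all $x$, $U(F(t,x))\subseteq M(x)$ and each $U(u)$, $u\in F(t,x)$, is of the form $(\alpha,k,u)$. Then $\langle M,H\rangle\rightsquigarrow_{b}^{(t,k)}\langle M',H'\rangle$ (respectively $\rightsquigarrow_{c}^{(t,k)}$), where $H'$ is $H$ with $k$ removed from $H(t)$, and $M'(x)$ arises from $M(x)$ by removing $\bigcup_{u\in F(t,x)}\mathrm{con}(U(u),M(x))$ and adding $\bigcup_{u\in F(x,t),\,U(u)\in M(y)}\mathrm{con}(U(u),(M(y)\setminus\mathrm{post}(t,U))\cup\mathrm{pre}(t,U))$, where every token $(\alpha,k,u)$ is replaced by $\alpha$. **Out-of-causal reversal.** For a set $C$ of instances, let $\mathrm{last}_T(C,H)$ be the $(t',l)$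 with $l\in H(t')$ of largest key such that $(\beta,l,v)\mathrel{\overline\in}\alpha$ for some token $\alpha\in C$ and $v\ne*$, and $\bot$ if there is none. Let $\mathrm{last}_P(C,H)$ be the unique place $y$ such that $(\beta,l,v)\mathrel{\overline\in}\alpha\in C$ with $v\in F(t',y)$ if $\mathrm{last}_T(C,H)=(t',l)$; the place $x$ with $C\subseteq M_0(x)$ after erasing all memories in $C$ if $\mathrm{last}_T(C,H)=\bot$; and undefined if there is no such place. Let $k\in H(t)$. $(t,k)$ is o-enabled via $U$ if each $U(u)$ is a token in $M$ with $(\alpha,k,u)\mathrel{\overline\in}U(u)$ for some $\alpha$, $(U(u),U(v))$ is a bond in $M$ for every $(u,v)\in\mathrm{effects}(t)$, and whenever $(\alpha,k',u')\mathrel{\overline\in}U(u)$, $(\beta,k',v')\mathrel{\overline\in}U(v)$ with $u',v'\ne *$, $k'>k$, $k'\in H(t')$: if $(u,v)\in\mathrm{guard}(t)\setminus\mathrm{effects}(t)$ then $(u',v')\notin\mathrm{effects}(t')\setminus\mathrm{guard}(t')$, and if $(u,v)\in\mathrm{effects}(t)\setminus\mathrm{guard}(t)$ then $(u',v')\notin\mathrm{guard}(t')\setminus\mathrm{effects}(t')$.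 Then $\langle M,H\rangle\rightsquigarrow_{o}^{(t,k)}\langle M',H'\rangle$ with $H'$ as before and $M'$ as follows. For a token $\alpha$ in $M$ put $C_\alpha=\mathrm{con}(\alpha,(\bigcup_zM(z)\setminus\mathrm{post}(t,U))\cup\mathrm{pre}(t,U))$. The memory update of a token of $C_\alpha$ removes all memories later than $\mathrm{last}_T(C_\alpha,H')$ and the memory with key $k$; if $\mathrm{last}_T(C_\alpha,H')=\bot$, it removes all memories. From each place $x$, remove $\mathrm{post}(t,U)$ and all $C_\alpha$ with $\alpha\in M(x)$ such that $\mathrm{last}_P(C_\alpha,H')\ne x$ or some memory in $C_\alpha$ is changed by the update; then add, with updated memories, all $C_\alpha$ with $\mathrm{last}_P(C_\alpha,H')=x$. **Claim.** Let $\langle M,H\rangle$ be a state reached from $\langle M_0,H_0\rangle$ by forward steps and causal reversals. 1. If $(t,k)$ is c-enabled in $\langle M,H\rangle$, then for every state $\langle M',H'\rangle$: $\langle M,H\rangle\rightsquigarrow_{c}^{(t,k)}\langle M',H'\rangle$ if and only if $\langle M,H\rangle\rightsquigarrow_{o}^{(t,k)}\langle M',H'\rangle$. 2. If $(t,k)$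 is bt-enabled in $\langle M,H\rangle$, then for every state $\langle M',H'\rangle$: $\langle M,H\rangle\rightsquigarrow_{b}^{(t,k)}\langle M',H'\rangle$ if and only if $\langle M,H\rangle\rightsquigarrow_{o}^{(t,k)}\langle M',H'\rangle$. 3. Hence, as labelled relations with such states as sources, $\rightsquigarrow_b\;\subseteq\;\rightsquigarrow_c\;\subseteq\;\rightsquigarrow_o$ for every well-formed net and initial marking, and there are a well-formed net and an initial marking for which both inclusions are strict. -/

import Mathlib

/-- Elements of `X ∪ (X × X)`, with pairs read as undirected bonds: either a stand-alone element
of `X`, or a bond between two elements of `X`. Used both for arc labels (`X` = token variables) and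
for the contents of places (`X` = token instances). -/
inductive Item (X : Type*) where
  | tok (a : X) : Item X
  | bond (b : Sym2 X) : Item X

/-- Apply a function to an element, or to both ends of a bond. -/
def Item.map {X Y : Type*} (f : X → Y) : Item X → Item Y
  | .tok a => .tok (f a)
  | .bond b => .bond (b.map f)

/-- Token instances over token types `A` and variables `V`: `init a i` is the initial token
`(a, *, i)`, and `step a k u` is `(a, k, u)`, the token `a` after taking part in the transition
occurrence with key `k`, as variable `u`, or passively if `u = none` (written `*`). -/
inductive TokenInst (A V : Type*) where
  | init (a : A) (i : ℕ) : TokenInst A V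
  | step (a : TokenInst A V) (k : ℕ) (u : Option V) : TokenInst A V

namespace TokenInst

variable {A V : Type*}

/-- The type of a token instance. -/
def type : TokenInst A V → A
  | init a _ => a
  | step a _ _ => a.type

/-- `a.EvolvesTo b`: `b` is `a` with zero or more further memories. -/
inductive EvolvesTo : TokenInst A V → TokenInst A V → Prop where
  | refl (a : TokenInst A V) : EvolvesTo a a
  | step {a b : TokenInst A V} (k : ℕ) (u : Option V) :
      EvolvesTo a b → EvolvesTo a (TokenInst.step b k u)

/-- The initial token `(a, *, i)` from which a token instance has evolved. -/
def origin : TokenInst A V → TokenInst A V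
  | init a i => init a i
  | step a _ _ => a.origin

/-- Discard the outermost memories whose key is larger than `l`. -/
def truncate (l : ℕ) : TokenInst A V → TokenInst A V
  | init a i => init a i
  | step a k u => if k ≤ l then step a k u else a.truncate l

/-- Discard the memory with key `k`, if there is one, and keep all the others. -/
def forget (k : ℕ) : TokenInst A V → TokenInst A V
  | init a i => init a i
  | step a l u => if l = k then a.forget k else step (a.forget k) l u

end TokenInst

section Connected

variable {X : Type*}

/-- One step of a path of bonds in `C`. -/
def BondStep (C : Set (Item X)) (a b : X) : Prop :=
  Item.bond s(a, b) ∈ C ∧ Item.tok b ∈ C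

/-- The tokens connected to `a` by a sequence of bonds in `C`, and the bonds on such sequences. -/
def connected (a : X) (C : Set (Item X)) : Set (Item X) :=
  {e | e = Item.tok a ∧ Item.tok a ∈ C} ∪
    {e | ∃ b c, Relation.ReflTransGen (BondStep C) a b ∧ BondStep C b c ∧
      (e = Item.bond s(b, c) ∨ e = Item.tok b ∨ e = Item.tok c)}

end Connected

/-- A multi reversing Petri net with places `P`, transitions `T`, token types `A` and token
variables `V`. `arcIn x t` and `arcOut t x` are the labels of the arcs from `x` to `t` and from `t` to
`x`. The bonds on an arc connect variables on that arc, and are of the bond types of the net. -/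
structure MRPN (P T A V : Type*) where
  type : V → A
  B : Set (Sym2 A)
  arcIn : P → T → Set (Item V)
  arcOut : T → P → Set (Item V)
  arcIn_bond : ∀ x t u v, Item.bond s(u, v) ∈ arcIn x t →
    Item.tok u ∈ arcIn x t ∧ Item.tok v ∈ arcIn x t ∧ s(type u, type v) ∈ B
  arcOut_bond : ∀ t x u v, Item.bond s(u, v) ∈ arcOut t x →
    Item.tok u ∈ arcOut t x ∧ Item.tok v ∈ arcOut t x ∧ s(type u, type v) ∈ B

namespace MRPN

/-- A marking assigns to each place a set of token and bond instances. -/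
abbrev Marking (P A V : Type*) := P → Set (Item (TokenInst A V))

/-- A history assigns to each transition the keys of its occurrences not reversed so far. -/
abbrev History (T : Type*) := T → Set ℕ

/-- A state `⟨M, H⟩`. -/
@[ext] structure State (P T A V : Type*) where
  M : Marking P A V
  H : History T

variable {P T A V : Type*} (N : MRPN P T A V)

/-- The union of the labels on the incoming arcs of `t`. -/
def guard (t : T) : Set (Item V) := ⋃ x, N.arcIn x t

/-- The union of the labels on the outgoing arcs of `t`. -/
def effects (t : T) : Set (Item V) := ⋃ x, N.arcOut t x

/-- Well-formedness: transitions neither create nor erase tokens, and do not clone them. -/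
def WellFormed : Prop :=
  ∀ t, (∀ u, Item.tok u ∈ N.guard t ↔ Item.tok u ∈ N.effects t) ∧
    ∀ x y u, x ≠ y → ¬ (Item.tok u ∈ N.arcOut t x ∧ Item.tok u ∈ N.arcOut t y)

/-- An initial marking: all tokens are of the form `(a, *, i)`, no token occurs in two places, and
bonds are of the bond types of the net and connect tokens of the place that they are in. -/
def IsInitialMarking (M₀ : Marking P A V) : Prop :=
  (∀ x a, Item.tok a ∈ M₀ x → ∃ b i, a = TokenInst.init b i) ∧
  (∀ x y a, Item.tok a ∈ M₀ x → Item.tok a ∈ M₀ y → x = y) ∧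
  (∀ x a b, Item.bond s(a, b) ∈ M₀ x →
    Item.tok a ∈ M₀ x ∧ Item.tok b ∈ M₀ x ∧ s(a.type, b.type) ∈ N.B)

/-- The selected instances according to the incoming arcs of `t`. -/
def pre (t : T) (U : V → TokenInst A V) : Set (Item (TokenInst A V)) :=
  Item.map U '' N.guard t

/-- The selected instances according to the outgoing arcs of `t`. -/
def post (t : T) (U : V → TokenInst A V) : Set (Item (TokenInst A V)) :=
  Item.map U '' N.effects t

/-! ### Forward execution -/

/-- `U` is a forward enabling assignment of `t` in `s`. Only the values of `U` at the variables of
`t` matter. -/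
def FwdAssignment (s : State P T A V) (t : T) (U : V → TokenInst A V) : Prop :=
  Set.InjOn U {u | Item.tok u ∈ N.guard t} ∧
  (∀ x u, Item.tok u ∈ N.arcIn x t → Item.tok (U u) ∈ s.M x ∧ N.type u = (U u).type) ∧
  (∀ x u v, Item.bond s(u, v) ∈ N.arcIn x t → Item.bond s(U u, U v) ∈ s.M x) ∧
  (∀ x u v, Item.tok u ∈ N.arcIn x t → Item.tok v ∈ N.arcIn x t →
    Item.bond s(U u, U v) ∈ s.M x → Item.bond s(u, v) ∈ N.arcIn x t) ∧
  (∀ y₁ y₂ u v, Item.tok u ∈ N.arcOut t y₁ → Item.tok v ∈ N.arcOut t y₂ → y₁ ≠ y₂ →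
    ∀ x, (N.arcIn x t).Nonempty →
      Item.tok (U u) ∉ connected (U v) ((s.M x \ N.pre t U) ∪ N.post t U))

/-- The instances taken from place `x` by the firing of `t`. -/
def fwdIn (s : State P T A V) (t : T) (U : V → TokenInst A V) (x : P) :
    Set (Item (TokenInst A V)) :=
  {e | ∃ u, Item.tok u ∈ N.arcIn x t ∧ e ∈ connected (U u) (s.M x)}

/-- The instances, before their memories are extended, put into place `x` by the firing of `t`. -/
def fwdOut (s : State P T A V) (t : T) (U : V → TokenInst A V) (x : P) :
    Set (Item (TokenInst A V)) :=
  {e | ∃ u y, Item.tok u ∈ N.arcOut t x ∧ Item.tok (U u) ∈ s.M y ∧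
    e ∈ connected (U u) ((s.M y \ N.pre t U) ∪ N.post t U)}

open Classical in
/-- The variable of `t` to which `U` assigns the token `a`, or `none` if there is no such one. -/
noncomputable def varOf (t : T) (U : V → TokenInst A V) (a : TokenInst A V) : Option V :=
  if h : ∃ u, Item.tok u ∈ N.guard t ∧ U u = a then some h.choose else none

/-- Forward execution of `t` with the key `k`. -/
def FwdStep (s : State P T A V) (t : T) (k : ℕ) (s' : State P T A V) : Prop :=
  (∃ m, IsGreatest ({0} ∪ {l | ∃ t', l ∈ s.H t'}) m ∧ k = m + 1) ∧
  (∃ U, N.FwdAssignment s t U ∧ ∀ x, s'.M x = (s.M x \ N.fwdIn s t U x) ∪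
    Item.map (fun a => TokenInst.step a k (N.varOf t U a)) '' N.fwdOut s t U x) ∧
  (∀ t' l, l ∈ s'.H t' ↔ l ∈ s.H t' ∨ (t' = t ∧ l = k))

/-! ### Backtracking and causal-order reversal -/

/-- `(t, k)` is a transition occurrence in `s`. -/
def Occurs (s : State P T A V) (t : T) (k : ℕ) : Prop := k ∈ s.H t

/-- The history after the reversal of `(t, k)`. -/
def revHistory (H : History T) (t : T) (k : ℕ) : History T :=
  fun t' => {l | l ∈ H t' ∧ ¬ (t' = t ∧ l = k)}

/-- `U` assigns to the variables of `t` token instances, in the outgoing places of `t`, whose last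
memory is the participation in the occurrence `(t, k)` as that variable, bonded as required by the
outgoing arcs. -/
def RevAssignment (s : State P T A V) (t : T) (k : ℕ) (U : V → TokenInst A V) : Prop :=
  Set.InjOn U {u | Item.tok u ∈ N.effects t} ∧
  (∀ x u, Item.tok u ∈ N.arcOut t x → (∃ a, U u = TokenInst.step a k (some u)) ∧
    Item.tok (U u) ∈ s.M x ∧ N.type u = (U u).type) ∧
  (∀ x u v, Item.bond s(u, v) ∈ N.arcOut t x → Item.bond s(U u, U v) ∈ s.M x)

/-- The instances taken from place `x` by the reversal of `t`. -/
def revIn (s : State P T A V) (t : T) (U : V → TokenInst A V) (x : P) :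
    Set (Item (TokenInst A V)) :=
  {e | ∃ u, Item.tok u ∈ N.arcOut t x ∧ e ∈ connected (U u) (s.M x)}

/-- The instances, before their memories are reduced, put into place `x` by the reversal of `t`. -/
def revOut (s : State P T A V) (t : T) (U : V → TokenInst A V) (x : P) :
    Set (Item (TokenInst A V)) :=
  {e | ∃ u y, Item.tok u ∈ N.arcIn x t ∧ Item.tok (U u) ∈ s.M y ∧
    e ∈ connected (U u) ((s.M y \ N.post t U) ∪ N.pre t U)}

/-- The marking after backtracking or causal-order reversal of `(t, k)` with assignment `U`. -/
def revMarking (s : State P T A V) (t : T) (k : ℕ) (U : V → TokenInst A V) : Marking P A V :=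
  fun x => (s.M x \ N.revIn s t U x) ∪
    ({e | ∃ a u, e = Item.tok a ∧ Item.tok (TokenInst.step a k u) ∈ N.revOut s t U x} ∪
     {e | ∃ a b u v, e = Item.bond s(a, b) ∧
        Item.bond s(TokenInst.step a k u, TokenInst.step b k v) ∈ N.revOut s t U x})

/-- `U` is a backtracking enabling assignment of `(t, k)` in `s`. -/
def BtAssignment (s : State P T A V) (t : T) (k : ℕ) (U : V → TokenInst A V) : Prop :=
  (Occurs s t k ∧ ∀ t' k', Occurs s t' k' → k' ≤ k) ∧ N.RevAssignment s t k U

/-- `(t, k)` is bt-enabled in `s`. -/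
def BtEnabled (s : State P T A V) (t : T) (k : ℕ) : Prop := ∃ U, N.BtAssignment s t k U

/-- Backtracking of `(t, k)`. -/
def BtStep (s : State P T A V) (t : T) (k : ℕ) (s' : State P T A V) : Prop :=
  ∃ U, N.BtAssignment s t k U ∧ s'.M = N.revMarking s t k U ∧ s'.H = revHistory s.H t k

/-- `(t', k')` causally depends on `(t, k)` in `s`: some token took part in both. -/
def CausallyPrecedes (s : State P T A V) (t : T) (k : ℕ) (t' : T) (k' : ℕ) : Prop :=
  Occurs s t k ∧ Occurs s t' k' ∧ k < k' ∧
  ∃ x a, Item.tok a ∈ s.M x ∧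
    (∃ b u, (TokenInst.step b k u).EvolvesTo a) ∧ (∃ b u, (TokenInst.step b k' u).EvolvesTo a)

/-- `U` is a causal enabling assignment of `(t, k)` in `s`. -/
def CAssignment (s : State P T A V) (t : T) (k : ℕ) (U : V → TokenInst A V) : Prop :=
  (Occurs s t k ∧ ¬ ∃ t' k', CausallyPrecedes s t k t' k') ∧ N.RevAssignment s t k U

/-- `(t, k)` is c-enabled in `s`. -/
def CEnabled (s : State P T A V) (t : T) (k : ℕ) : Prop := ∃ U, N.CAssignment s t k U

/-- Causal-order reversal of `(t, k)`. -/
def CStep (s : State P T A V) (t : T) (k : ℕ) (s' : State P T A V) : Prop :=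
  ∃ U, N.CAssignment s t k U ∧ s'.M = N.revMarking s t k U ∧ s'.H = revHistory s.H t k

/-! ### Out-of-causal-order reversal -/

/-- `U` is an out-of-causal-order enabling assignment of `(t, k)` in `s`. The last two clauses say
that the breaking, respectively the creation, of a bond by `(t, k)` has not been undone by a later
occurrence. -/
def OAssignment (s : State P T A V) (t : T) (k : ℕ) (U : V → TokenInst A V) : Prop :=
  Occurs s t k ∧
  Set.InjOn U {u | Item.tok u ∈ N.effects t} ∧
  (∀ u, Item.tok u ∈ N.effects t → (∃ a, (TokenInst.step a k (some u)).EvolvesTo (U u)) ∧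
    (∃ y, Item.tok (U u) ∈ s.M y) ∧ N.type u = (U u).type) ∧
  (∀ u v, Item.bond s(u, v) ∈ N.effects t → ∃ y, Item.bond s(U u, U v) ∈ s.M y) ∧
  (∀ u v, Item.bond s(u, v) ∈ N.guard t → Item.bond s(u, v) ∉ N.effects t →
    ∀ a b k' u' v', (TokenInst.step a k' (some u')).EvolvesTo (U u) →
      (TokenInst.step b k' (some v')).EvolvesTo (U v) →
      ¬ ∃ t', k' ∈ s.H t' ∧ k < k' ∧
        Item.bond s(u', v') ∈ N.effects t' ∧ Item.bond s(u', v') ∉ N.guard t') ∧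
  (∀ u v, Item.bond s(u, v) ∈ N.effects t → Item.bond s(u, v) ∉ N.guard t →
    ∀ a b k' u' v', (TokenInst.step a k' (some u')).EvolvesTo (U u) →
      (TokenInst.step b k' (some v')).EvolvesTo (U v) →
      ¬ ∃ t', k' ∈ s.H t' ∧ k < k' ∧
        Item.bond s(u', v') ∈ N.guard t' ∧ Item.bond s(u', v') ∉ N.effects t')

/-- `(t, k)` is o-enabled in `s`. -/
def OEnabled (s : State P T A V) (t : T) (k : ℕ) : Prop := ∃ U, N.OAssignment s t k U

/-- The occurrence `(t, k)`, not reversed, has actively manipulated a token of `C`. -/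
def Manipulates (C : Set (Item (TokenInst A V))) (H : History T) (t : T) (k : ℕ) : Prop :=
  k ∈ H t ∧ ∃ a b u, Item.tok a ∈ C ∧ (TokenInst.step b k (some u)).EvolvesTo a

/-- `IsLastT C H L`: `L` is the last occurrence in `H` that has actively manipulated a token of
`C`; `none` stands for the absence of such an occurrence. -/
def IsLastT (C : Set (Item (TokenInst A V))) (H : History T) : Option (T × ℕ) → Prop
  | some (t, k) => Manipulates C H t k ∧ ¬ ∃ t' k', k < k' ∧ Manipulates C H t' k'
  | none => ¬ ∃ t k, Manipulates C H t k

/-- `IsLastP M₀ C H x`: `x` is the unique outgoing place of the last occurrence that manipulated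
`C`, at a variable that this occurrence assigned to a token of `C`; or, if there is no such
occurrence, the place in which `C` existed, with the memories of its tokens erased, in the initial
marking. -/
def IsLastP (M₀ : Marking P A V) (C : Set (Item (TokenInst A V))) (H : History T) (x : P) : Prop :=
  (∃ t k, IsLastT C H (some (t, k)) ∧
    {y | ∃ a b u, Item.tok a ∈ C ∧ (TokenInst.step b k (some u)).EvolvesTo a ∧
      Item.tok u ∈ N.arcOut t y} = {x}) ∨
  (IsLastT C H none ∧ ∀ e ∈ C, Item.map TokenInst.origin e ∈ M₀ x)

/-- The component of `a` once the effect of `t` on the selected instances has been undone. -/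
def component (s : State P T A V) (t : T) (U : V → TokenInst A V) (a : TokenInst A V) :
    Set (Item (TokenInst A V)) :=
  connected a (({e | ∃ c z, e ∈ connected c (s.M z)} \ N.post t U) ∪ N.pre t U)

/-- The memory update of a token, on the reversal of an occurrence with key `k`, in a component
last manipulated by `L`: the memories later than `L`, and the memory with key `k`, are removed; if
there is no `L`, the token becomes the initial one. -/
def lastA (L : Option (T × ℕ)) (k : ℕ) (a : TokenInst A V) : TokenInst A V :=
  match L with
  | some (_, l) => (a.truncate l).forget k
  | none => a.origin

/-- The instances removed from place `x`: the instances selected by `t`, the components that do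
not belong to `x` any more, and the components some memory of which is updated. -/
def oIn (M₀ : Marking P A V) (s : State P T A V) (t : T) (k : ℕ) (U : V → TokenInst A V) (x : P) :
    Set (Item (TokenInst A V)) :=
  N.post t U ∪
    {e | ∃ a, Item.tok a ∈ s.M x ∧ e ∈ N.component s t U a ∧
      (¬ N.IsLastP M₀ (N.component s t U a) (revHistory s.H t k) x ∨
        ∃ L, IsLastT (N.component s t U a) (revHistory s.H t k) L ∧
          ∃ b, Item.tok b ∈ N.component s t U a ∧ lastA L k b ≠ b)}

/-- The instances put into place `x`: the components that belong to `x`, with memories updated. -/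
def oOut (M₀ : Marking P A V) (s : State P T A V) (t : T) (k : ℕ) (U : V → TokenInst A V) (x : P) :
    Set (Item (TokenInst A V)) :=
  {e | ∃ a y L, Item.tok a ∈ s.M y ∧
    IsLastT (N.component s t U a) (revHistory s.H t k) L ∧
    N.IsLastP M₀ (N.component s t U a) (revHistory s.H t k) x ∧
    e ∈ Item.map (lastA L k) '' N.component s t U a}

/-- Out-of-causal-order reversal of `(t, k)`. -/
def OStep (M₀ : Marking P A V) (s : State P T A V) (t : T) (k : ℕ) (s' : State P T A V) : Prop :=
  ∃ U, N.OAssignment s t k U ∧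
    (∀ x, s'.M x = (s.M x \ N.oIn M₀ s t k U x) ∪ N.oOut M₀ s t k U x) ∧
    s'.H = revHistory s.H t k

/-! ### Executions and transition relations -/

/-- The initial state: no transition has occurred. -/
def initialState (M₀ : Marking P A V) : State P T A V := ⟨M₀, fun _ => ∅⟩

/-- `s` is reached from the initial state by an execution that consists of forward steps and
causal-order reversals. -/
def Reachable (M₀ : Marking P A V) (s : State P T A V) : Prop :=
  Relation.ReflTransGen (fun s₁ s₂ => ∃ t k, N.FwdStep s₁ t k s₂ ∨ N.CStep s₁ t k s₂)
    (initialState M₀) s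

/-- The labelled transition relation of backtracking, on reachable states. -/
def btRel (M₀ : Marking P A V) : Set (State P T A V × (T × ℕ) × State P T A V) :=
  {r | N.Reachable M₀ r.1 ∧ N.BtStep r.1 r.2.1.1 r.2.1.2 r.2.2}

/-- The labelled transition relation of causal-order reversal, on reachable states. -/
def cRel (M₀ : Marking P A V) : Set (State P T A V × (T × ℕ) × State P T A V) :=
  {r | N.Reachable M₀ r.1 ∧ N.CStep r.1 r.2.1.1 r.2.1.2 r.2.2}

/-- The labelled transition relation of out-of-causal-order reversal, on reachable states. -/
def oRel (M₀ : Marking P A V) : Set (State P T A V × (T × ℕ) × State P T A V) :=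
  {r | N.Reachable M₀ r.1 ∧ N.OStep M₀ r.1 r.2.1.1 r.2.1.2 r.2.2}

end MRPN

/-!
A state reached by forward steps and causal reversals is already reached by forward steps alone, if
their keys may be arbitrary increasing numbers. Indeed, no token that an occurrence without causal
successors has put into a place is used by a later occurrence, so the occurrence commutes with the
later ones and can be cancelled from the execution. Causal reversal leads to the state of the
shortened execution.

Out-of-causal reversal of such an occurrence leads to the same state. The components that it forms
are those of the shortened execution, except that some tokens carry an additional memory with the
key of the reversed occurrence. In a state of a forward execution, each component lies in the place
into which it was put by the occurrence with the latest of its keys, or in its initial place if it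
has no key. Hence removing the additional memory is all that the update does.

Both inclusions are strict already for two tokens that move along a chain of two transitions: if
one moves after the other, the first move can be reversed in causal order but not by backtracking;
if the same token moves twice, its first move can be reversed only out of causal order.
-/

/-! ### Graphs with tokens as vertices and bonds as edges -/

namespace Item

variable {X Y Z : Type*}

/-- The tokens that an item involves: the element itself, or the two ends of a bond. -/
def ends : Item X → Set X
  | tok a => {a}
  | bond b => {x | x ∈ b}

@[simp] theorem mem_ends_tok {a b : X} : b ∈ (tok a).ends ↔ b = a := Iff.rfl

@[simp] theorem mem_ends_bond {a : X} {b : Sym2 X} : a ∈ (bond b).ends ↔ a ∈ b := Iff.rfl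

theorem ends_nonempty : ∀ e : Item X, e.ends.Nonempty
  | tok a => ⟨a, rfl⟩
  | bond b => by
    induction b with
    | h a b => exact ⟨a, Sym2.mem_mk_left a b⟩

@[simp] theorem map_tok (f : X → Y) (a : X) : (tok a).map f = tok (f a) := rfl

@[simp] theorem map_bond (f : X → Y) (a b : X) :
    (bond s(a, b)).map f = bond s(f a, f b) := rfl

theorem mem_ends_map {f : X → Y} {e : Item X} {b : Y} :
    b ∈ (e.map f).ends ↔ ∃ a ∈ e.ends, f a = b := by
  cases e with
  | tok a => simp [eq_comm]
  | bond p => simp [Item.map, Sym2.mem_map]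

theorem map_congr {f g : X → Y} {e : Item X} (h : ∀ a ∈ e.ends, f a = g a) :
    e.map f = e.map g := by
  cases e with
  | tok a => simp [h a rfl]
  | bond p => exact congrArg bond (Sym2.map_congr h)

theorem map_map (f : X → Y) (g : Y → Z) (e : Item X) : (e.map f).map g = e.map (g ∘ f) := by
  cases e with
  | tok a => rfl
  | bond p => simp [Item.map, Sym2.map_map]

theorem map_eq_self {f : X → X} {e : Item X} (h : ∀ a ∈ e.ends, f a = a) : e.map f = e := by
  rw [map_congr (g := id) h]
  cases e with
  | tok a => rfl
  | bond p => simp [Item.map]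

theorem map_injective {f : X → Y} (hf : Function.Injective f) :
    Function.Injective (Item.map f) := by
  intro e e' h
  cases e <;> cases e' <;> simp only [Item.map, tok.injEq, bond.injEq, reduceCtorEq] at h
  · rw [hf h]
  · rw [Sym2.map.injective hf h]

theorem tok_mem_map_image {f : X → Y} {C : Set (Item X)} {b : Y} :
    tok b ∈ Item.map f '' C ↔ ∃ a, tok a ∈ C ∧ f a = b := by
  constructor
  · rintro ⟨e, he, h⟩
    cases e with
    | tok a => exact ⟨a, he, by simpa using h⟩
    | bond p => simp [Item.map] at h
  · rintro ⟨a, ha, rfl⟩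
    exact ⟨_, ha, rfl⟩

theorem bond_mem_map_image {f : X → Y} {C : Set (Item X)} {b c : Y} :
    bond s(b, c) ∈ Item.map f '' C ↔ ∃ a a', bond s(a, a') ∈ C ∧ f a = b ∧ f a' = c := by
  constructor
  · rintro ⟨e, he, h⟩
    cases e with
    | tok a => simp at h
    | bond p =>
      induction p with
      | h a a' =>
        simp only [map_bond, bond.injEq, Sym2.eq_iff] at h
        rcases h with ⟨h, h'⟩ | ⟨h, h'⟩
        · exact ⟨a, a', he, h, h'⟩
        · exact ⟨a', a, by rwa [Sym2.eq_swap], h', h⟩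
  · rintro ⟨a, a', ha, rfl, rfl⟩
    exact ⟨_, ha, rfl⟩

end Item

section Graph

variable {X Y : Type*}

/-- `C` is a graph with tokens as vertices and bonds as edges: it contains the ends of its bonds. -/
def IsGraph (C : Set (Item X)) : Prop := ∀ e ∈ C, ∀ a ∈ e.ends, Item.tok a ∈ C

/-- `a` and `b` are connected by a path of bonds in `C`. -/
def Conn (C : Set (Item X)) : X → X → Prop :=
  Relation.ReflTransGen fun a b => Item.bond s(a, b) ∈ C

/-- The part of `C` that is connected to an element of `B`. -/
def reach (C : Set (Item X)) (B : Set X) : Set (Item X) :=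
  {e | e ∈ C ∧ ∃ a ∈ B, ∃ b ∈ e.ends, Conn C a b}

/-- No bond of `C` leaves `D`. For graphs `D ⊆ C` this says that `D` is a union of connected
components of `C`. -/
def ClosedIn (D C : Set (Item X)) : Prop := ∀ e ∈ C, ∀ a ∈ e.ends, Item.tok a ∈ D → e ∈ D

theorem isGraph_iff {C : Set (Item X)} :
    IsGraph C ↔ ∀ a b, Item.bond s(a, b) ∈ C → Item.tok a ∈ C ∧ Item.tok b ∈ C := by
  constructor
  · exact fun h a b hab => ⟨h _ hab a (by simp), h _ hab b (by simp)⟩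
  · rintro h (c | p) he a ha
    · rwa [Item.mem_ends_tok.1 ha]
    · induction p with
      | h b c =>
        obtain rfl | rfl := Sym2.mem_iff.1 ha
        exacts [(h _ _ he).1, (h _ _ he).2]

theorem IsGraph.map {C : Set (Item X)} (hC : IsGraph C) (f : X → Y) :
    IsGraph (Item.map f '' C) := by
  rintro _ ⟨e, he, rfl⟩ b hb
  obtain ⟨a, ha, rfl⟩ := Item.mem_ends_map.1 hb
  exact ⟨_, hC e he a ha, rfl⟩

theorem IsGraph.iUnion {ι : Sort*} {C : ι → Set (Item X)} (hC : ∀ i, IsGraph (C i)) :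
    IsGraph (⋃ i, C i) := by
  intro e he a ha
  obtain ⟨i, hi⟩ := Set.mem_iUnion.1 he
  exact Set.mem_iUnion.2 ⟨i, hC i e hi a ha⟩

theorem IsGraph.diff_union {C Q R : Set (Item X)} (hC : IsGraph C) (hR : IsGraph R)
    (hQR : ∀ a, Item.tok a ∈ Q → Item.tok a ∈ R) : IsGraph ((C \ Q) ∪ R) := by
  rintro e (⟨he, -⟩ | he) a ha
  · by_cases h : Item.tok a ∈ Q
    · exact Or.inr (hQR a h)
    · exact Or.inl ⟨hC e he a ha, h⟩
  · exact Or.inr (hR e he a ha)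

theorem IsGraph.diff {C Q : Set (Item X)} (hC : IsGraph C) (hQ : ClosedIn Q C) :
    IsGraph (C \ Q) :=
  fun e he a ha => ⟨hC e he.1 a ha, fun haQ => he.2 (hQ e he.1 a ha haQ)⟩

theorem IsGraph.closedIn_diff {Q : Set (Item X)} (hQ : IsGraph Q) (C : Set (Item X)) :
    ClosedIn (C \ Q) C :=
  fun e he a ha haQ => ⟨he, fun heQ => haQ.2 (hQ e heQ a ha)⟩

theorem ClosedIn.trans {C D E : Set (Item X)} (hDE : ClosedIn D E) (hsub : D ⊆ E)
    (hEC : ClosedIn E C) : ClosedIn D C :=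
  fun e he a ha haD => hDE e (hEC e he a ha (hsub haD)) a ha haD

theorem ClosedIn.union_of_disjoint {A B : Set (Item X)} (hB : IsGraph B)
    (h : ∀ a, Item.tok a ∈ A → Item.tok a ∉ B) : ClosedIn A (A ∪ B) := by
  rintro e (he | he) a ha haA
  · exact he
  · exact (h a haA (hB e he a ha)).elim

namespace Conn

variable {C D : Set (Item X)} {a b c : X}

theorem refl (C : Set (Item X)) (a : X) : Conn C a a := Relation.ReflTransGen.refl

theorem tail (h : Conn C a b) (hbc : Item.bond s(b, c) ∈ C) : Conn C a c :=
  Relation.ReflTransGen.tail h hbc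

theorem trans (h : Conn C a b) (h' : Conn C b c) : Conn C a c := Relation.ReflTransGen.trans h h'

theorem symm (h : Conn C a b) : Conn C b a := by
  induction h with
  | refl => exact refl C a
  | tail _ hbc ih => exact Relation.ReflTransGen.head (by rwa [Sym2.eq_swap]) ih

theorem mono (hCD : C ⊆ D) (h : Conn C a b) : Conn D a b :=
  Relation.ReflTransGen.lift id (fun _ _ h => hCD h) _ _ h

theorem of_mem_ends {e : Item X} (he : e ∈ C) (hb : b ∈ e.ends) (hc : c ∈ e.ends) :
    Conn C b c := by
  cases e with
  | tok d =>
    rw [Item.mem_ends_tok.1 hb, Item.mem_ends_tok.1 hc]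
    exact refl C d
  | bond p =>
    by_cases hbc : b = c
    · exact hbc ▸ refl C b
    · have hp : p = s(b, c) := (Sym2.mem_and_mem_iff hbc).1 ⟨hb, hc⟩
      exact (refl C b).tail (hp ▸ he)

theorem restrict (h : Conn C a b) (hD : IsGraph D) (hDC : ClosedIn D C) (ha : Item.tok a ∈ D) :
    Conn D a b ∧ Item.tok b ∈ D := by
  induction h with
  | refl => exact ⟨refl D a, ha⟩
  | tail _ hbc ih =>
    have hbcD := hDC _ hbc _ (by simp) ih.2
    exact ⟨ih.1.tail hbcD, hD _ hbcD _ (by simp)⟩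

theorem tok_mem (h : Conn C a b) (hC : IsGraph C) (ha : Item.tok a ∈ C) : Item.tok b ∈ C :=
  (h.restrict hC (fun _ he _ _ _ => he) ha).2

theorem map (h : Conn C a b) (f : X → Y) : Conn (Item.map f '' C) (f a) (f b) :=
  Relation.ReflTransGen.lift f (fun _ _ h => ⟨_, h, rfl⟩) _ _ h

theorem of_map {f : X → Y} (hC : IsGraph C) (hf : Set.InjOn f {a | Item.tok a ∈ C})
    (ha : Item.tok a ∈ C) {b : Y} (h : Conn (Item.map f '' C) (f a) b) :
    ∃ c, f c = b ∧ Conn C a c := by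
  induction h with
  | refl => exact ⟨a, rfl, refl C a⟩
  | tail _ h ih =>
    obtain ⟨c, rfl, hc⟩ := ih
    obtain ⟨d, d', hd, hdc, rfl⟩ := Item.bond_mem_map_image.1 h
    have : d = c := hf (isGraph_iff.1 hC _ _ hd).1 (hc.tok_mem hC ha) hdc
    exact ⟨d', rfl, hc.tail (this ▸ hd)⟩

end Conn

theorem reach_subset (C : Set (Item X)) (B : Set X) : reach C B ⊆ C := fun _ h => h.1

theorem closedIn_reach (C : Set (Item X)) (B : Set X) : ClosedIn (reach C B) C := by
  rintro e he b hb ⟨-, a, ha, c, hc, hac⟩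
  exact ⟨he, a, ha, b, hb, Item.mem_ends_tok.1 hc ▸ hac⟩

theorem isGraph_reach {C : Set (Item X)} (hC : IsGraph C) (B : Set X) : IsGraph (reach C B) := by
  rintro e ⟨he, a, ha, b, hb, hab⟩ c hc
  exact ⟨hC e he c hc, a, ha, c, rfl, hab.trans (.of_mem_ends he hb hc)⟩

theorem map_image_reach {f : X → Y} {C : Set (Item X)} (hC : IsGraph C)
    (hf : Set.InjOn f {a | Item.tok a ∈ C}) {B : Set X} (hB : ∀ a ∈ B, Item.tok a ∈ C) :
    Item.map f '' reach C B = reach (Item.map f '' C) (f '' B) := by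
  ext e'
  constructor
  · rintro ⟨e, ⟨he, a, ha, b, hb, hab⟩, rfl⟩
    exact ⟨⟨e, he, rfl⟩, f a, ⟨a, ha, rfl⟩, f b, Item.mem_ends_map.2 ⟨b, hb, rfl⟩, hab.map f⟩
  · rintro ⟨⟨e, he, rfl⟩, _, ⟨a, ha, rfl⟩, _, hb, hab⟩
    obtain ⟨b, hb', rfl⟩ := Item.mem_ends_map.1 hb
    obtain ⟨c, hc, hac⟩ := Conn.of_map hC hf (hB a ha) hab
    have : c = b := hf (hac.tok_mem hC (hB a ha)) (hC e he b hb') hc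
    exact ⟨e, ⟨he, a, ha, b, hb', this ▸ hac⟩, rfl⟩

theorem reflTransGen_bondStep_iff {C : Set (Item X)} (hC : IsGraph C) {a b : X} :
    Relation.ReflTransGen (BondStep C) a b ↔ Conn C a b :=
  ⟨fun h => Relation.ReflTransGen.lift id (fun _ _ h => h.1) _ _ h,
    fun h => Relation.ReflTransGen.lift id (fun _ _ h => ⟨h, (isGraph_iff.1 hC _ _ h).2⟩) _ _ h⟩

theorem connected_eq_reach {C : Set (Item X)} (hC : IsGraph C) {a : X} (ha : Item.tok a ∈ C) :
    connected a C = reach C {a} := by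
  ext e
  constructor
  · rintro (⟨rfl, -⟩ | ⟨b, c, hb, hbc, rfl | rfl | rfl⟩)
    · exact ⟨ha, a, rfl, a, rfl, Conn.refl C a⟩
    · exact ⟨hbc.1, a, rfl, b, by simp, (reflTransGen_bondStep_iff hC).1 hb⟩
    · exact ⟨hC _ hbc.1 b (by simp), a, rfl, b, rfl, (reflTransGen_bondStep_iff hC).1 hb⟩
    · exact ⟨hbc.2, a, rfl, c, rfl, ((reflTransGen_bondStep_iff hC).1 hb).tail hbc.1⟩
  · rintro ⟨he, _, rfl, b, hb, hab⟩
    cases e with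
    | tok c =>
      obtain rfl := Item.mem_ends_tok.1 hb
      rcases Relation.ReflTransGen.cases_tail hab with rfl | ⟨c, hc, hcb⟩
      · exact Or.inl ⟨rfl, ha⟩
      · exact Or.inr ⟨c, b, (reflTransGen_bondStep_iff hC).2 hc, ⟨hcb, he⟩, Or.inr (Or.inr rfl)⟩
    | bond p =>
      induction p with
      | h c d =>
        have hac : Conn C _ c := hab.trans (.of_mem_ends he hb (by simp))
        exact Or.inr ⟨c, d, (reflTransGen_bondStep_iff hC).2 hac,
          ⟨he, (isGraph_iff.1 hC _ _ he).2⟩, Or.inl rfl⟩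

theorem mem_connected {C : Set (Item X)} (hC : IsGraph C) {a : X} (ha : Item.tok a ∈ C)
    {e : Item X} : e ∈ connected a C ↔ e ∈ C ∧ ∃ b ∈ e.ends, Conn C a b := by
  rw [connected_eq_reach hC ha]
  simp [reach]

theorem connected_subset {C : Set (Item X)} (hC : IsGraph C) (a : X) : connected a C ⊆ C := by
  rintro e (⟨rfl, h⟩ | ⟨b, c, -, ⟨h, h'⟩, rfl | rfl | rfl⟩)
  exacts [h, h, hC _ h b (by simp), h']

theorem tok_mem_connected {C : Set (Item X)} (hC : IsGraph C) {a : X} (ha : Item.tok a ∈ C)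
    {b : X} : Item.tok b ∈ connected a C ↔ Conn C a b := by
  rw [mem_connected hC ha]
  constructor
  · rintro ⟨-, c, rfl, h⟩
    exact h
  · exact fun h => ⟨h.tok_mem hC ha, b, rfl, h⟩

theorem isGraph_connected {C : Set (Item X)} (hC : IsGraph C) {a : X} (ha : Item.tok a ∈ C) :
    IsGraph (connected a C) := by
  rw [connected_eq_reach hC ha]
  exact isGraph_reach hC _

theorem self_mem_connected {C : Set (Item X)} {a : X} (ha : Item.tok a ∈ C) :
    Item.tok a ∈ connected a C := Or.inl ⟨rfl, ha⟩

theorem mem_connected_of_mem_ends {C : Set (Item X)} (hC : IsGraph C) {e : Item X} (he : e ∈ C)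
    {a : X} (ha : a ∈ e.ends) : e ∈ connected a C :=
  (mem_connected hC (hC e he a ha)).2 ⟨he, a, ha, Conn.refl C a⟩

theorem setOf_mem_connected_eq_iUnion {ι : Type*} {m : ι → Set (Item X)}
    (hm : ∀ i, IsGraph (m i)) : {e | ∃ a i, e ∈ connected a (m i)} = ⋃ i, m i := by
  ext e
  constructor
  · rintro ⟨a, i, he⟩
    exact Set.mem_iUnion.2 ⟨i, connected_subset (hm i) a he⟩
  · intro he
    obtain ⟨i, hi⟩ := Set.mem_iUnion.1 he
    obtain ⟨a, ha⟩ := e.ends_nonempty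
    exact ⟨a, i, mem_connected_of_mem_ends (hm i) hi ha⟩

theorem setOf_connected_eq_reach {C : Set (Item X)} (hC : IsGraph C) {ι : Type*} {p : ι → Prop}
    {f : ι → X} (hf : ∀ i, p i → Item.tok (f i) ∈ C) :
    {e | ∃ i, p i ∧ e ∈ connected (f i) C} = reach C (f '' {i | p i}) := by
  ext e
  constructor
  · rintro ⟨i, hi, he⟩
    obtain ⟨he, b, hb, h⟩ := (mem_connected hC (hf i hi)).1 he
    exact ⟨he, f i, ⟨i, hi, rfl⟩, b, hb, h⟩
  · rintro ⟨he, _, ⟨i, hi, rfl⟩, b, hb, h⟩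
    exact ⟨i, hi, (mem_connected hC (hf i hi)).2 ⟨he, b, hb, h⟩⟩

theorem connected_map {f : X → Y} {C : Set (Item X)} (hC : IsGraph C)
    (hf : Set.InjOn f {a | Item.tok a ∈ C}) {a : X} (ha : Item.tok a ∈ C) :
    connected (f a) (Item.map f '' C) = Item.map f '' connected a C := by
  rw [connected_eq_reach hC ha, connected_eq_reach (hC.map f) ⟨_, ha, rfl⟩,
    map_image_reach hC hf (by simpa using ha), Set.image_singleton]

theorem reach_eq_of_closedIn {C E : Set (Item X)} (hE : IsGraph E) (hEC : E ⊆ C)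
    (hcl : ClosedIn E C) {B : Set X} (hB : ∀ a ∈ B, Item.tok a ∈ E) : reach C B = reach E B := by
  ext e
  constructor
  · rintro ⟨he, a, ha, b, hb, hab⟩
    obtain ⟨habE, hbE⟩ := hab.restrict hE hcl (hB a ha)
    exact ⟨hcl e he b hb hbE, a, ha, b, hb, habE⟩
  · rintro ⟨he, a, ha, b, hb, hab⟩
    exact ⟨hEC he, a, ha, b, hb, hab.mono hEC⟩

theorem connected_eq_of_closedIn {C E : Set (Item X)} (hC : IsGraph C) (hE : IsGraph E)
    (hEC : E ⊆ C) (hcl : ClosedIn E C) {a : X} (ha : Item.tok a ∈ E) :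
    connected a C = connected a E := by
  rw [connected_eq_reach hC (hEC ha), connected_eq_reach hE ha,
    reach_eq_of_closedIn hE hEC hcl (by simpa using ha)]

end Graph

/-! ### Exchange of labelled bonds -/

section Switch

variable {P V X Y : Type*}

/-- The instances that `U` selects by the labels `ℓ x`, for all places `x`. -/
def selected (ℓ : P → Set (Item V)) (U : V → X) : Set (Item X) := Item.map U '' ⋃ x, ℓ x

/-- The part of `W` that is connected to the elements selected by the label `ℓ x`. -/
def labelPart (ℓ : P → Set (Item V)) (U : V → X) (W : Set (Item X)) (x : P) : Set (Item X) :=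
  reach W (U '' {u | Item.tok u ∈ ℓ x})

/-- `W` is a graph that contains the instances selected by the labels `ℓ`, and each of its connected
components contains selected elements of exactly one label. -/
structure LabelledBy (ℓ : P → Set (Item V)) (U : V → X) (W : Set (Item X)) : Prop where
  label : ∀ x, IsGraph (ℓ x)
  graph : IsGraph W
  selected_subset : selected ℓ U ⊆ W
  hom : ∀ x y u v, Item.tok u ∈ ℓ x → Item.tok v ∈ ℓ y → Conn W (U u) (U v) → x = y
  cover : ∀ e ∈ W, ∃ x, e ∈ labelPart ℓ U W x

/-- `W'` arises from `W` by exchanging the instances that `U` selects by the labels `ℓ` for those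
that it selects by the labels `ℓ'`, and vice versa. -/
structure Switch (ℓ ℓ' : P → Set (Item V)) (U : V → X) (W W' : Set (Item X)) : Prop where
  before : LabelledBy ℓ U W
  after : LabelledBy ℓ' U W'
  vars : ∀ u, Item.tok u ∈ ⋃ x, ℓ x ↔ Item.tok u ∈ ⋃ x, ℓ' x
  after_eq : W' = (W \ selected ℓ U) ∪ selected ℓ' U
  before_eq : W = (W' \ selected ℓ' U) ∪ selected ℓ U

variable {ℓ ℓ' : P → Set (Item V)} {U U' : V → X} {W W' : Set (Item X)}

theorem map_mem_selected {x : P} {e : Item V} (he : e ∈ ℓ x) : e.map U ∈ selected ℓ U :=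
  ⟨e, Set.mem_iUnion.2 ⟨x, he⟩, rfl⟩

theorem tok_mem_selected {a : X} :
    Item.tok a ∈ selected ℓ U ↔ ∃ u x, Item.tok u ∈ ℓ x ∧ U u = a := by
  simp only [selected, Item.tok_mem_map_image, Set.mem_iUnion]
  tauto

theorem isGraph_selected (hℓ : ∀ x, IsGraph (ℓ x)) : IsGraph (selected ℓ U) :=
  (IsGraph.iUnion hℓ).map U

theorem tok_mem_selected_congr (h : ∀ u, Item.tok u ∈ ⋃ x, ℓ x ↔ Item.tok u ∈ ⋃ x, ℓ' x)
    (a : X) : Item.tok a ∈ selected ℓ U ↔ Item.tok a ∈ selected ℓ' U := by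
  simp only [selected, Item.tok_mem_map_image, h]

theorem selected_comp (ℓ : P → Set (Item V)) (U : V → X) (g : X → Y) :
    selected ℓ (g ∘ U) = Item.map g '' selected ℓ U := by
  simp only [selected, Set.image_image, Item.map_map]

theorem selected_congr (hℓ : ∀ x, IsGraph (ℓ x)) (h : ∀ x u, Item.tok u ∈ ℓ x → U u = U' u) :
    selected ℓ U = selected ℓ U' := by
  refine Set.image_congr fun e he => ?_
  obtain ⟨x, hx⟩ := Set.mem_iUnion.1 he
  exact Item.map_congr fun u hu => h x u (hℓ x e hx u hu)

theorem labelPart_congr {x : P} (h : ∀ u, Item.tok u ∈ ℓ x → U u = U' u) (W : Set (Item X)) :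
    labelPart ℓ U W x = labelPart ℓ U' W x := by
  have himage : U '' {u | Item.tok u ∈ ℓ x} = U' '' {u | Item.tok u ∈ ℓ x} := Set.image_congr h
  rw [labelPart, labelPart, himage]

theorem map_mem_labelPart {x : P} {e : Item V} (hℓ : IsGraph (ℓ x)) (he : e ∈ ℓ x)
    (heW : e.map U ∈ W) : e.map U ∈ labelPart ℓ U W x := by
  obtain ⟨u, hu⟩ := e.ends_nonempty
  exact ⟨heW, U u, ⟨u, hℓ e he u hu, rfl⟩, U u, Item.mem_ends_map.2 ⟨u, hu, rfl⟩, Conn.refl _ _⟩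

namespace LabelledBy

theorem var_mem (h : LabelledBy ℓ U W) {u : V} {x : P} (hu : Item.tok u ∈ ℓ x) :
    Item.tok (U u) ∈ W :=
  h.selected_subset (map_mem_selected hu)

theorem map_image_labelPart (h : LabelledBy ℓ U W) {g : X → Y}
    (hg : Set.InjOn g {a | Item.tok a ∈ W}) (x : P) :
    Item.map g '' labelPart ℓ U W x = labelPart ℓ (g ∘ U) (Item.map g '' W) x := by
  rw [labelPart, labelPart, Set.image_comp, map_image_reach h.graph hg]
  rintro _ ⟨u, hu, rfl⟩
  exact h.var_mem hu

theorem map (h : LabelledBy ℓ U W) {g : X → Y} (hg : Function.Injective g) :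
    LabelledBy ℓ (g ∘ U) (Item.map g '' W) where
  label := h.label
  graph := h.graph.map g
  selected_subset := by
    rw [selected_comp]
    exact Set.image_mono h.selected_subset
  hom x y u v hu hv huv := by
    obtain ⟨c, hc, huc⟩ := Conn.of_map h.graph hg.injOn (h.var_mem hu) huv
    exact h.hom x y u v hu hv (hg hc ▸ huc)
  cover := by
    rintro _ ⟨e, he, rfl⟩
    obtain ⟨x, hx⟩ := h.cover e he
    exact ⟨x, h.map_image_labelPart hg.injOn x ▸ ⟨e, hx, rfl⟩⟩

theorem congr (h : LabelledBy ℓ U W) (hU : ∀ x u, Item.tok u ∈ ℓ x → U u = U' u) :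
    LabelledBy ℓ U' W where
  label := h.label
  graph := h.graph
  selected_subset := selected_congr h.label hU ▸ h.selected_subset
  hom x y u v hu hv := by
    rw [← hU x u hu, ← hU y v hv]
    exact h.hom x y u v hu hv
  cover e he := by
    obtain ⟨x, hx⟩ := h.cover e he
    exact ⟨x, labelPart_congr (hU x) W ▸ hx⟩

theorem eq_of_mem_labelPart (h : LabelledBy ℓ U W) {x y : P} {a : X}
    (hx : Item.tok a ∈ labelPart ℓ U W x) (hy : Item.tok a ∈ labelPart ℓ U W y) : x = y := by
  obtain ⟨-, _, ⟨u, hu, rfl⟩, b, rfl, hub⟩ := hx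
  obtain ⟨-, _, ⟨v, hv, rfl⟩, b, rfl, hvb⟩ := hy
  exact h.hom x y u v hu hv (hub.trans hvb.symm)

theorem exists_conn_diff_union (h : LabelledBy ℓ U W)
    (hvars : ∀ u, Item.tok u ∈ ⋃ x, ℓ x ↔ Item.tok u ∈ ⋃ x, ℓ' x) {u : V} {x : P} {b : X}
    (hu : Item.tok u ∈ ℓ x) (hub : Conn W (U u) b) :
    ∃ v y, Item.tok v ∈ ℓ' y ∧ Conn ((W \ selected ℓ U) ∪ selected ℓ' U) (U v) b := by
  induction hub with
  | refl =>
    obtain ⟨y, hy⟩ := Set.mem_iUnion.1 ((hvars u).1 (Set.mem_iUnion.2 ⟨x, hu⟩))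
    exact ⟨u, y, hy, Conn.refl _ _⟩
  | @tail b c _ hbc ih =>
    by_cases hsel : Item.bond s(b, c) ∈ selected ℓ U
    · obtain ⟨v, y, hv, rfl⟩ :=
        tok_mem_selected.1 ((tok_mem_selected_congr hvars c).1
          (isGraph_selected h.label _ hsel c (by simp)))
      exact ⟨v, y, hv, Conn.refl _ _⟩
    · obtain ⟨v, y, hv, hvb⟩ := ih
      exact ⟨v, y, hv, hvb.tail (Or.inl ⟨hbc, hsel⟩)⟩

/-- Each component still has a label after the exchange: a path to a selected element either keeps
all of its bonds or contains an end of a bond that is taken away, which is itself selected. -/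
theorem switch (h : LabelledBy ℓ U W) (hℓ' : ∀ x, IsGraph (ℓ' x))
    (hvars : ∀ u, Item.tok u ∈ ⋃ x, ℓ x ↔ Item.tok u ∈ ⋃ x, ℓ' x)
    (hinter : W ∩ selected ℓ' U ⊆ selected ℓ U)
    (hhom : ∀ x y u v, Item.tok u ∈ ℓ' x → Item.tok v ∈ ℓ' y →
      Conn ((W \ selected ℓ U) ∪ selected ℓ' U) (U u) (U v) → x = y) :
    Switch ℓ ℓ' U W ((W \ selected ℓ U) ∪ selected ℓ' U) where
  before := h
  after :=
    { label := hℓ'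
      graph := h.graph.diff_union (isGraph_selected hℓ') fun a =>
        (tok_mem_selected_congr hvars a).1
      selected_subset := Set.subset_union_right
      hom := hhom
      cover := by
        rintro e (he | ⟨e, he, rfl⟩)
        · obtain ⟨x, -, _, ⟨u, hu, rfl⟩, b, hb, hub⟩ := h.cover e he.1
          obtain ⟨v, y, hv, hvb⟩ := h.exists_conn_diff_union hvars hu hub
          exact ⟨y, Or.inl he, U v, ⟨v, hv, rfl⟩, b, hb, hvb⟩
        · obtain ⟨x, hx⟩ := Set.mem_iUnion.1 he
          exact ⟨x, map_mem_labelPart (hℓ' x) hx (Or.inr (map_mem_selected hx))⟩ }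
  vars := hvars
  after_eq := rfl
  before_eq := by
    ext e
    have hsub := @h.selected_subset e
    have hinter := @hinter e
    simp only [Set.mem_inter_iff, Set.mem_union, Set.mem_sdiff] at hinter ⊢
    tauto

end LabelledBy

namespace Switch

theorem symm (h : Switch ℓ ℓ' U W W') : Switch ℓ' ℓ U W' W :=
  ⟨h.after, h.before, fun u => (h.vars u).symm, h.before_eq, h.after_eq⟩

theorem tok_mem_after (h : Switch ℓ ℓ' U W W') {a : X} (ha : Item.tok a ∈ W) :
    Item.tok a ∈ W' := by
  rw [h.after_eq]
  by_cases hsel : Item.tok a ∈ selected ℓ U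
  · exact Or.inr ((tok_mem_selected_congr h.vars a).1 hsel)
  · exact Or.inl ⟨ha, hsel⟩

theorem tok_mem_iff (h : Switch ℓ ℓ' U W W') (a : X) : Item.tok a ∈ W ↔ Item.tok a ∈ W' :=
  ⟨h.tok_mem_after, h.symm.tok_mem_after⟩

theorem map (h : Switch ℓ ℓ' U W W') {g : X → Y} (hg : Function.Injective g) :
    Switch ℓ ℓ' (g ∘ U) (Item.map g '' W) (Item.map g '' W') := by
  have hinj := Item.map_injective hg
  refine ⟨h.before.map hg, h.after.map hg, h.vars, ?_, ?_⟩
  · rw [selected_comp, selected_comp, ← Set.image_sdiff hinj, ← Set.image_union, ← h.after_eq]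
  · rw [selected_comp, selected_comp, ← Set.image_sdiff hinj, ← Set.image_union, ← h.before_eq]

theorem congr (h : Switch ℓ ℓ' U W W')
    (hU : ∀ u, Item.tok u ∈ ⋃ x, ℓ x → U u = U' u) : Switch ℓ ℓ' U' W W' := by
  have hℓ : ∀ x u, Item.tok u ∈ ℓ x → U u = U' u := fun x u hu =>
    hU u (Set.mem_iUnion.2 ⟨x, hu⟩)
  have hℓ' : ∀ x u, Item.tok u ∈ ℓ' x → U u = U' u := fun x u hu =>
    hU u ((h.vars u).2 (Set.mem_iUnion.2 ⟨x, hu⟩))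
  refine ⟨h.before.congr hℓ, h.after.congr hℓ', h.vars, ?_, ?_⟩
  · rw [← selected_congr h.before.label hℓ, ← selected_congr h.after.label hℓ', ← h.after_eq]
  · rw [← selected_congr h.before.label hℓ, ← selected_congr h.after.label hℓ', ← h.before_eq]

end Switch

/-- A family of graphs without common elements: the contents of the places of a net. -/
structure DisjointGraphs (m : P → Set (Item X)) : Prop where
  graph : ∀ x, IsGraph (m x)
  uniq : ∀ x y a, Item.tok a ∈ m x → Item.tok a ∈ m y → x = y

namespace DisjointGraphs

variable {m : P → Set (Item X)}

theorem closedIn (hm : DisjointGraphs m) (x : P) : ClosedIn (m x) (⋃ y, m y) := by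
  intro e he a ha hax
  obtain ⟨y, hy⟩ := Set.mem_iUnion.1 he
  rwa [hm.uniq x y a hax (hm.graph y e hy a ha)]

end DisjointGraphs

/-- `W` is a union of connected components of places of `m`, in which the instances `Q` are to be
exchanged for those selected by the labels `ℓ`, such that doing so within each single place does not
connect different labels. -/
structure LocalExchange (m : P → Set (Item X)) (W Q : Set (Item X)) (ℓ : P → Set (Item V))
    (U : V → X) : Prop where
  places : DisjointGraphs m
  graph : IsGraph W
  subset : W ⊆ ⋃ x, m x
  closed : ∀ x, ClosedIn W (m x)
  label : ∀ x, IsGraph (ℓ x)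
  var_mem : ∀ x u, Item.tok u ∈ ℓ x → Item.tok (U u) ∈ W
  tok_selected : ∀ a, Item.tok a ∈ Q → Item.tok a ∈ selected ℓ U
  local_hom : ∀ x y z u v, Item.tok u ∈ ℓ x → Item.tok v ∈ ℓ y → Item.tok (U u) ∈ m z →
    Conn ((m z \ Q) ∪ selected ℓ U) (U u) (U v) → x = y

namespace LocalExchange

variable {m : P → Set (Item X)} {Q : Set (Item X)}

theorem isGraph_place (h : LocalExchange m W Q ℓ U) (x : P) :
    IsGraph ((m x \ Q) ∪ selected ℓ U) :=
  (h.places.graph x).diff_union (isGraph_selected h.label) h.tok_selected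

theorem isGraph (h : LocalExchange m W Q ℓ U) : IsGraph ((W \ Q) ∪ selected ℓ U) :=
  h.graph.diff_union (isGraph_selected h.label) h.tok_selected

theorem closedIn_place (h : LocalExchange m W Q ℓ U) (x : P) :
    ClosedIn ((W \ Q) ∪ selected ℓ U) ((m x \ Q) ∪ selected ℓ U) := by
  rintro e (he | he) a ha haW
  · refine Or.inl ⟨h.closed x e he.1 a ha ?_, he.2⟩
    rcases haW with haW | haW
    · exact haW.1
    · obtain ⟨u, y, hu, rfl⟩ := tok_mem_selected.1 haW
      exact h.var_mem y u hu
  · exact Or.inr he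

/-- As long as a path does not use a new bond it stays within one place, and a new bond leads to a
selected element of the same label, from which the path can be started anew. -/
theorem exists_local_conn (h : LocalExchange m W Q ℓ U) {u : V} {x : P} {b : X}
    (hu : Item.tok u ∈ ℓ x) (hub : Conn ((W \ Q) ∪ selected ℓ U) (U u) b) :
    ∃ w z, Item.tok w ∈ ℓ x ∧ Item.tok (U w) ∈ m z ∧ Item.tok b ∈ m z ∧
      Conn ((m z \ Q) ∪ selected ℓ U) (U w) b := by
  induction hub with
  | refl =>
    obtain ⟨z, hz⟩ := Set.mem_iUnion.1 (h.subset (h.var_mem x u hu))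
    exact ⟨u, z, hu, hz, hz, Conn.refl _ _⟩
  | tail _ hbc ih =>
    obtain ⟨w, z, hw, hwz, hbz, hwb⟩ := ih
    rcases hbc with ⟨hbc, hQ⟩ | hbc
    · have hbcz := h.places.closedIn z _ (h.subset hbc) _ (by simp) hbz
      exact ⟨w, z, hw, hwz, h.places.graph z _ hbcz _ (by simp), hwb.tail (Or.inl ⟨hbcz, hQ⟩)⟩
    · obtain ⟨v, v', hvv, rfl, rfl⟩ := Item.bond_mem_map_image.1 hbc
      obtain ⟨y, hy⟩ := Set.mem_iUnion.1 hvv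
      have hends := isGraph_iff.1 (h.label y) _ _ hy
      obtain rfl := h.local_hom x y z w v hw hends.1 hwz hwb
      obtain ⟨z', hz'⟩ := Set.mem_iUnion.1 (h.subset (h.var_mem x v' hends.2))
      exact ⟨v', z', hends.2, hz', hz', Conn.refl _ _⟩

theorem hom (h : LocalExchange m W Q ℓ U) (x y : P) (u v : V) (hu : Item.tok u ∈ ℓ x)
    (hv : Item.tok v ∈ ℓ y) (huv : Conn ((W \ Q) ∪ selected ℓ U) (U u) (U v)) : x = y := by
  obtain ⟨w, z, hw, hwz, -, hwv⟩ := h.exists_local_conn hu huv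
  exact h.local_hom x y z w v hw hv hwz hwv

theorem exists_mem_local_connected (h : LocalExchange m W Q ℓ U) {x : P} {e : Item X}
    (he : e ∈ labelPart ℓ U ((W \ Q) ∪ selected ℓ U) x) :
    ∃ u y, Item.tok u ∈ ℓ x ∧ Item.tok (U u) ∈ m y ∧
      e ∈ connected (U u) ((m y \ Q) ∪ selected ℓ U) := by
  obtain ⟨he, _, ⟨u, hu, rfl⟩, b, hb, hub⟩ := he
  obtain ⟨w, z, hw, hwz, hbz, hwb⟩ := h.exists_local_conn hu hub
  rcases he with ⟨he, hQ⟩ | he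
  · have hez := h.places.closedIn z e (h.subset he) b hb hbz
    exact ⟨w, z, hw, hwz, (mem_connected (h.isGraph_place z) (Or.inr (map_mem_selected hw))).2
      ⟨Or.inl ⟨hez, hQ⟩, b, hb, hwb⟩⟩
  · have hes := he
    obtain ⟨e, he, rfl⟩ := he
    obtain ⟨v, hv, rfl⟩ := Item.mem_ends_map.1 hb
    obtain ⟨y, hy⟩ := Set.mem_iUnion.1 he
    have hvy := h.label y e hy v hv
    obtain rfl := h.local_hom x y z w v hw hvy hwz hwb
    exact ⟨v, z, hvy, hbz, (mem_connected (h.isGraph_place z) (Or.inr (map_mem_selected hvy))).2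
      ⟨Or.inr hes, U v, hb, Conn.refl _ _⟩⟩

theorem setOf_local_connected_eq_labelPart (h : LocalExchange m W Q ℓ U) (x : P) :
    {e | ∃ u y, Item.tok u ∈ ℓ x ∧ Item.tok (U u) ∈ m y ∧
      e ∈ connected (U u) ((m y \ Q) ∪ selected ℓ U)} =
    labelPart ℓ U ((W \ Q) ∪ selected ℓ U) x := by
  refine Set.Subset.antisymm ?_ fun e => h.exists_mem_local_connected
  rintro e ⟨u, y, hu, -, he⟩
  have husel : Item.tok (U u) ∈ selected ℓ U := map_mem_selected hu
  obtain ⟨he, b, hb, hub⟩ := (mem_connected (h.isGraph_place y) (Or.inr husel)).1 he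
  obtain ⟨hubW, hbW⟩ := hub.restrict h.isGraph (h.closedIn_place y) (Or.inr husel)
  exact ⟨h.closedIn_place y e he b hb hbW, U u, ⟨u, hu, rfl⟩, b, hb, hubW⟩

end LocalExchange

end Switch

/-! ### Keys of token instances -/

namespace TokenInst

variable {A V : Type*}

/-- The keys of the memories of a token instance. -/
def keys (a : TokenInst A V) : Set ℕ := {l | ∃ b u, (step b l u).EvolvesTo a}

theorem evolvesTo_init {a : TokenInst A V} {b : A} {i : ℕ} :
    a.EvolvesTo (init b i) ↔ a = init b i := by
  constructor
  · rintro ⟨⟩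
    rfl
  · rintro rfl
    exact .refl _

theorem evolvesTo_step {a b : TokenInst A V} {k : ℕ} {u : Option V} :
    a.EvolvesTo (step b k u) ↔ a = step b k u ∨ a.EvolvesTo b := by
  constructor
  · intro h
    cases h with
    | refl => exact Or.inl rfl
    | step _ _ h => exact Or.inr h
  · rintro (rfl | h)
    · exact .refl _
    · exact .step k u h

theorem mem_keys_of_evolvesTo {a b : TokenInst A V} {k : ℕ} {u : Option V}
    (h : (step b k u).EvolvesTo a) : k ∈ a.keys := ⟨b, u, h⟩

@[simp] theorem keys_init (a : A) (i : ℕ) : (init a i : TokenInst A V).keys = ∅ := by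
  ext l
  simp [keys, evolvesTo_init]

@[simp] theorem mem_keys_step {a : TokenInst A V} {k l : ℕ} {u : Option V} :
    l ∈ (step a k u).keys ↔ l = k ∨ l ∈ a.keys := by
  simp only [keys, evolvesTo_step, Set.mem_ofPred_eq, step.injEq]
  constructor
  · rintro ⟨b, v, ⟨-, h, -⟩ | h⟩
    exacts [Or.inl h, Or.inr ⟨b, v, h⟩]
  · rintro (rfl | ⟨b, v, h⟩)
    exacts [⟨a, u, Or.inl ⟨rfl, rfl, rfl⟩⟩, ⟨b, v, Or.inr h⟩]

theorem origin_eq_self {a : TokenInst A V} (h : a.keys = ∅) : a.origin = a := by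
  cases a with
  | init => rfl
  | step a k u =>
    have hk : k ∈ (step a k u).keys := by simp
    simp [h] at hk

theorem truncate_eq_self {a : TokenInst A V} {l : ℕ} (h : ∀ k ∈ a.keys, k ≤ l) :
    a.truncate l = a := by
  cases a with
  | init => rfl
  | step a k u => simp [truncate, h k (by simp)]

theorem forget_eq_self {a : TokenInst A V} {k : ℕ} (h : k ∉ a.keys) : a.forget k = a := by
  induction a with
  | init => rfl
  | step a l u ih =>
    simp only [mem_keys_step, not_or] at h
    simp [forget, Ne.symm h.1, ih h.2]

theorem forget_step {a : TokenInst A V} {k : ℕ} (h : k ∉ a.keys) (u : Option V) :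
    (step a k u).forget k = a := by
  simp [forget, forget_eq_self h]

end TokenInst

/-! ### Occurrences -/

namespace MRPN

section Occurrence

variable {P T A V : Type*} (N : MRPN P T A V)

/-- The local effect of an occurrence of `t` with key `key`: the components `before` of the tokens
that take part in it become `after`, before their memories are extended. -/
structure Occurrence where
  t : T
  key : ℕ
  U : V → TokenInst A V
  before : Set (Item (TokenInst A V))
  after : Set (Item (TokenInst A V))
  inj : Set.InjOn U {u | Item.tok u ∈ N.guard t}
  switch : Switch (fun x => N.arcIn x t) (N.arcOut t) U before after

variable {N}

namespace Occurrence

variable (o : N.Occurrence)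

/-- The instances that the occurrence takes from place `x`. -/
def inPart (x : P) : Set (Item (TokenInst A V)) :=
  labelPart (fun y => N.arcIn y o.t) o.U o.before x

/-- The instances that the occurrence puts into place `x`, before their memories are extended. -/
def outPart (x : P) : Set (Item (TokenInst A V)) := labelPart (N.arcOut o.t) o.U o.after x

/-- The extension of the memory of a token that takes part in the occurrence. -/
noncomputable def extend (a : TokenInst A V) : TokenInst A V :=
  TokenInst.step a o.key (N.varOf o.t o.U a)

/-- The instances that the occurrence puts into place `x`. -/
def newPart (x : P) : Set (Item (TokenInst A V)) := Item.map o.extend '' o.outPart x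

/-- The state after the occurrence has taken place in `s`. -/
def fire (s : State P T A V) : State P T A V where
  M x := (s.M x \ o.inPart x) ∪ o.newPart x
  H t := {l | l ∈ s.H t ∨ (t = o.t ∧ l = o.key)}

/-- The state that results from `s` by undoing the occurrence. -/
def unfire (s : State P T A V) : State P T A V where
  M x := (s.M x \ o.newPart x) ∪ o.inPart x
  H := revHistory s.H o.t o.key

/-- The occurrence can take place in the marking `M`: what it takes are whole components of the
places from which it takes them. -/
structure Fits (M : Marking P A V) : Prop where
  inPart_subset : ∀ x, o.inPart x ⊆ M x
  closed : ∀ x, ClosedIn o.before (M x)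

variable {o}

theorem extend_injective : Function.Injective o.extend := fun _ _ h => (TokenInst.step.inj h).1

theorem key_mem_keys_extend (a : TokenInst A V) : o.key ∈ (o.extend a).keys := by
  simp [extend]

theorem extend_var {u : V} (hu : Item.tok u ∈ N.guard o.t) :
    o.extend (o.U u) = TokenInst.step (o.U u) o.key (some u) := by
  have h : ∃ v, Item.tok v ∈ N.guard o.t ∧ o.U v = o.U u := ⟨u, hu, rfl⟩
  rw [extend, varOf, dif_pos h, o.inj h.choose_spec.1 hu h.choose_spec.2]

theorem varOf_eq_some {t : T} {U : V → TokenInst A V} {a : TokenInst A V} {u : V}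
    (h : N.varOf t U a = some u) : Item.tok u ∈ N.guard t ∧ U u = a := by
  unfold varOf at h
  split_ifs at h with h'
  rw [← Option.some.inj h]
  exact h'.choose_spec

theorem isGraph_inPart (o : N.Occurrence) (x : P) : IsGraph (o.inPart x) :=
  isGraph_reach o.switch.before.graph _

theorem isGraph_outPart (o : N.Occurrence) (x : P) : IsGraph (o.outPart x) :=
  isGraph_reach o.switch.after.graph _

theorem isGraph_newPart (o : N.Occurrence) (x : P) : IsGraph (o.newPart x) :=
  (o.isGraph_outPart x).map _

theorem tok_mem_newPart {x : P} {a : TokenInst A V} (ha : Item.tok a ∈ o.newPart x) :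
    ∃ b, Item.tok b ∈ o.outPart x ∧ Item.tok b ∈ o.before ∧ o.extend b = a := by
  obtain ⟨b, hb, rfl⟩ := Item.tok_mem_map_image.1 ha
  exact ⟨b, hb, (o.switch.tok_mem_iff b).2 (reach_subset _ _ hb), rfl⟩

theorem key_mem_keys_of_newPart {x : P} {a : TokenInst A V} (ha : Item.tok a ∈ o.newPart x) :
    o.key ∈ a.keys := by
  obtain ⟨b, -, -, rfl⟩ := tok_mem_newPart ha
  exact key_mem_keys_extend b

namespace Fits

variable {M : Marking P A V}

theorem exists_mem (h : o.Fits M) {e : Item (TokenInst A V)} (he : e ∈ o.before) :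
    ∃ x, e ∈ o.inPart x ∧ e ∈ M x := by
  obtain ⟨x, hx⟩ := o.switch.before.cover e he
  exact ⟨x, hx, h.inPart_subset x hx⟩

theorem closedIn_inPart (h : o.Fits M) (x : P) : ClosedIn (o.inPart x) (M x) :=
  (closedIn_reach _ _).trans (reach_subset _ _) (h.closed x)

theorem notMem_before (h : o.Fits M) (hM : DisjointGraphs M) {x : P} {e : Item (TokenInst A V)}
    (he : e ∈ M x \ o.inPart x) {a : TokenInst A V} (ha : a ∈ e.ends) :
    Item.tok a ∉ o.before := by
  intro haW
  obtain ⟨y, hy, hyM⟩ := h.exists_mem (h.closed x e he.1 a ha haW)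
  obtain rfl := hM.uniq x y a (hM.graph x e he.1 a ha) (hM.graph y e hyM a ha)
  exact he.2 hy

end Fits

end Occurrence

end Occurrence

section Regular

variable {P T A V : Type*} (N : MRPN P T A V)

/-- No occurrence has changed the component `C` of place `x` of the initial marking. -/
def Untouched (M₀ : Marking P A V) (x : P) (C : Set (Item (TokenInst A V))) : Prop :=
  C ⊆ M₀ x ∧ ∀ b, Item.tok b ∈ C → b.keys = ∅

/-- `(t, l)` is the last occurrence that has changed the component `C`, and it has put into place
`x` all tokens of `C` that it manipulated. -/
structure PlacedBy (H : History T) (x : P) (C : Set (Item (TokenInst A V))) (t : T) (l : ℕ) :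
    Prop where
  occurs : l ∈ H t
  manipulated : ∃ b u, Item.tok (TokenInst.step b l (some u)) ∈ C
  keys_le : ∀ b, Item.tok b ∈ C → ∀ l' ∈ b.keys, l' ≤ l
  place : ∀ b, Item.tok b ∈ C → ∀ c u, (TokenInst.step c l (some u)).EvolvesTo b →
    Item.tok u ∈ N.arcOut t x

/-- The invariant of the reachable states: besides basic sanity conditions it says that the last
occurrence that has manipulated a component has put it into its place. -/
structure Regular (M₀ : Marking P A V) (s : State P T A V) : Prop extends DisjointGraphs s.M where
  keys : ∀ x a, Item.tok a ∈ s.M x → ∀ l ∈ a.keys, ∃ t, l ∈ s.H t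
  hist : ∀ t t' l, l ∈ s.H t → l ∈ s.H t' → t = t'
  comp : ∀ x a, Item.tok a ∈ s.M x → Untouched M₀ x (connected a (s.M x)) ∨
    ∃ t l, N.PlacedBy s.H x (connected a (s.M x)) t l

/-- The states that are reached by forward execution with arbitrary increasing keys. -/
inductive FwdReachable (M₀ : Marking P A V) : State P T A V → Prop
  | init : FwdReachable M₀ (initialState M₀)
  | fire {s : State P T A V} (o : N.Occurrence) : FwdReachable M₀ s →
      (∀ t l, l ∈ s.H t → l < o.key) → o.Fits s.M → FwdReachable M₀ (o.fire s)

variable {N} {M₀ : Marking P A V} {s : State P T A V}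

theorem PlacedBy.mono {H H' : History T} {x : P} {C : Set (Item (TokenInst A V))} {t : T} {l : ℕ}
    (h : N.PlacedBy H x C t l) (hl : l ∈ H' t) : N.PlacedBy H' x C t l :=
  { h with occurs := hl }

theorem regular_initialState (hM₀ : N.IsInitialMarking M₀) :
    N.Regular M₀ (initialState M₀ : State P T A V) := by
  have hgraph : ∀ x, IsGraph (M₀ x) := fun x =>
    isGraph_iff.2 fun a b h => ⟨(hM₀.2.2 x a b h).1, (hM₀.2.2 x a b h).2.1⟩
  have hkeys : ∀ x a, Item.tok a ∈ M₀ x → a.keys = ∅ := by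
    intro x a ha
    obtain ⟨b, i, rfl⟩ := hM₀.1 x a ha
    exact TokenInst.keys_init b i
  refine ⟨⟨hgraph, hM₀.2.1⟩, fun x a ha l hl => ?_, fun _ _ _ h => h.elim, fun x a _ => Or.inl
    ⟨connected_subset (hgraph x) a, fun b hb => hkeys x b (connected_subset (hgraph x) a hb)⟩⟩
  rw [hkeys x a ha] at hl
  exact hl.elim

namespace Regular

variable {o : N.Occurrence}

theorem key_notMem (hs : N.Regular M₀ s) {k : ℕ} (hk : ∀ t l, l ∈ s.H t → l < k) {x : P}
    {a : TokenInst A V} (ha : Item.tok a ∈ s.M x) : k ∉ a.keys := by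
  intro hka
  obtain ⟨t, ht⟩ := hs.keys x a ha k hka
  exact lt_irrefl k (hk t k ht)

theorem exists_mem_hist_of_before (hs : N.Regular M₀ s) (hfit : o.Fits s.M) {a : TokenInst A V}
    (ha : Item.tok a ∈ o.before) {l : ℕ} (hl : l ∈ a.keys) : ∃ t, l ∈ s.H t := by
  obtain ⟨y, -, hy⟩ := hfit.exists_mem ha
  exact hs.keys y a hy l hl

theorem disjointGraphs_fire (hs : N.Regular M₀ s) (hk : ∀ t l, l ∈ s.H t → l < o.key)
    (hfit : o.Fits s.M) : DisjointGraphs (o.fire s).M where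
  graph x := by
    rintro e (he | he) a ha
    · exact Or.inl ((hs.graph x).diff (hfit.closedIn_inPart x) e he a ha)
    · exact Or.inr (o.isGraph_newPart x e he a ha)
  uniq := by
    rintro x y a (hx | hx) (hy | hy)
    · exact hs.uniq x y a hx.1 hy.1
    · exact (hs.key_notMem hk hx.1 (Occurrence.key_mem_keys_of_newPart hy)).elim
    · exact (hs.key_notMem hk hy.1 (Occurrence.key_mem_keys_of_newPart hx)).elim
    · obtain ⟨b, hb, -, rfl⟩ := Occurrence.tok_mem_newPart hx
      obtain ⟨c, hc, -, hcb⟩ := Occurrence.tok_mem_newPart hy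
      obtain rfl := Occurrence.extend_injective hcb
      exact o.switch.after.eq_of_mem_labelPart hb hc

theorem connected_fire_of_mem_diff (hs : N.Regular M₀ s) (hk : ∀ t l, l ∈ s.H t → l < o.key)
    (hfit : o.Fits s.M) {x : P} {a : TokenInst A V} (ha : Item.tok a ∈ s.M x \ o.inPart x) :
    connected a ((o.fire s).M x) = connected a (s.M x) := by
  have hdiff := (hs.graph x).diff (hfit.closedIn_inPart x)
  have hdisj : ∀ b, Item.tok b ∈ s.M x \ o.inPart x → Item.tok b ∉ o.newPart x := fun b hb hb' =>
    hs.key_notMem hk hb.1 (Occurrence.key_mem_keys_of_newPart hb')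
  rw [connected_eq_of_closedIn ((hs.disjointGraphs_fire hk hfit).graph x) hdiff
      Set.subset_union_left (.union_of_disjoint (o.isGraph_newPart x) hdisj) ha,
    connected_eq_of_closedIn (hs.graph x) hdiff Set.sdiff_subset
      ((o.isGraph_inPart x).closedIn_diff _) ha]

theorem connected_fire_of_mem_newPart (hs : N.Regular M₀ s) (hk : ∀ t l, l ∈ s.H t → l < o.key)
    (hfit : o.Fits s.M) {x : P} {a : TokenInst A V} (ha : Item.tok a ∈ o.newPart x) :
    connected a ((o.fire s).M x) = connected a (o.newPart x) := by
  have hcl : ClosedIn (o.newPart x) ((s.M x \ o.inPart x) ∪ o.newPart x) := by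
    rw [Set.union_comm]
    exact .union_of_disjoint ((hs.graph x).diff (hfit.closedIn_inPart x)) fun b hb hb' =>
      hs.key_notMem hk hb'.1 (Occurrence.key_mem_keys_of_newPart hb)
  exact connected_eq_of_closedIn ((hs.disjointGraphs_fire hk hfit).graph x)
    (o.isGraph_newPart x) Set.subset_union_right hcl ha

theorem exists_var_mem_connected_newPart {x : P} {a : TokenInst A V}
    (ha : Item.tok a ∈ o.newPart x) :
    ∃ b u, Item.tok (TokenInst.step b o.key (some u)) ∈ connected a (o.newPart x) := by
  obtain ⟨b, hb, -, rfl⟩ := Occurrence.tok_mem_newPart ha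
  obtain ⟨-, _, ⟨u, hu, rfl⟩, _, rfl, hub⟩ := id hb
  have hug : Item.tok u ∈ N.guard o.t := (o.switch.vars u).2 (Set.mem_iUnion.2 ⟨x, hu⟩)
  refine ⟨o.U u, u, ?_⟩
  rw [← Occurrence.extend_var hug, tok_mem_connected (o.isGraph_newPart x) ha]
  exact (hub.symm.restrict (o.isGraph_outPart x) (closedIn_reach _ _) hb).1.map _

theorem placedBy_fire (hs : N.Regular M₀ s) (hk : ∀ t l, l ∈ s.H t → l < o.key)
    (hfit : o.Fits s.M) {x : P} {a : TokenInst A V} (ha : Item.tok a ∈ o.newPart x) :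
    N.PlacedBy (o.fire s).H x (connected a (o.newPart x)) o.t o.key where
  occurs := Or.inr ⟨rfl, rfl⟩
  manipulated := exists_var_mem_connected_newPart ha
  keys_le c hc l hl := by
    obtain ⟨b, -, hb, rfl⟩ :=
      Occurrence.tok_mem_newPart (connected_subset (o.isGraph_newPart x) a hc)
    rcases TokenInst.mem_keys_step.1 hl with rfl | hl
    · exact le_rfl
    · obtain ⟨t, ht⟩ := hs.exists_mem_hist_of_before hfit hb hl
      exact (hk t l ht).le
  place c hc d u hd := by
    obtain ⟨b, hbx, hb, rfl⟩ :=
      Occurrence.tok_mem_newPart (connected_subset (o.isGraph_newPart x) a hc)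
    rcases TokenInst.evolvesTo_step.1 hd with h | h
    · obtain ⟨rfl, -, h⟩ := TokenInst.step.inj h
      obtain ⟨hu, rfl⟩ := Occurrence.varOf_eq_some h.symm
      obtain ⟨y, hy⟩ := Set.mem_iUnion.1 ((o.switch.vars u).1 hu)
      have huy : Item.tok (o.U u) ∈ o.outPart y :=
        map_mem_labelPart (o.switch.after.label y) hy (reach_subset _ _ hbx)
      rwa [o.switch.after.eq_of_mem_labelPart hbx huy]
    · obtain ⟨t, ht⟩ :=
        hs.exists_mem_hist_of_before hfit hb (TokenInst.mem_keys_of_evolvesTo h)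
      exact (lt_irrefl _ (hk t _ ht)).elim

theorem keys_fire (hs : N.Regular M₀ s) (hfit : o.Fits s.M) {x : P} {a : TokenInst A V}
    (ha : Item.tok a ∈ (o.fire s).M x) {l : ℕ} (hl : l ∈ a.keys) : ∃ t, l ∈ (o.fire s).H t := by
  rcases ha with ha | ha
  · obtain ⟨t, ht⟩ := hs.keys x a ha.1 l hl
    exact ⟨t, Or.inl ht⟩
  · obtain ⟨b, -, hb, rfl⟩ := Occurrence.tok_mem_newPart ha
    rcases TokenInst.mem_keys_step.1 hl with rfl | hl
    · exact ⟨o.t, Or.inr ⟨rfl, rfl⟩⟩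
    · obtain ⟨t, ht⟩ := hs.exists_mem_hist_of_before hfit hb hl
      exact ⟨t, Or.inl ht⟩

theorem fire (hs : N.Regular M₀ s) (hk : ∀ t l, l ∈ s.H t → l < o.key) (hfit : o.Fits s.M) :
    N.Regular M₀ (o.fire s) where
  toDisjointGraphs := hs.disjointGraphs_fire hk hfit
  keys _ _ ha _ hl := hs.keys_fire hfit ha hl
  hist := by
    rintro t₁ t₂ l (h | ⟨rfl, rfl⟩) (h' | ⟨rfl, h'⟩)
    · exact hs.hist t₁ t₂ l h h'
    · exact (lt_irrefl l (h' ▸ hk t₁ l h)).elim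
    · exact (lt_irrefl _ (hk t₂ _ h')).elim
    · rfl
  comp := by
    rintro x a (ha | ha)
    · rw [hs.connected_fire_of_mem_diff hk hfit ha]
      exact (hs.comp x a ha.1).imp_right fun ⟨t, l, h⟩ => ⟨t, l, h.mono (Or.inl h.occurs)⟩
    · rw [hs.connected_fire_of_mem_newPart hk hfit ha]
      exact Or.inr ⟨o.t, o.key, hs.placedBy_fire hk hfit ha⟩

end Regular

theorem FwdReachable.regular (hM₀ : N.IsInitialMarking M₀) (h : N.FwdReachable M₀ s) :
    N.Regular M₀ s := by
  induction h with
  | init => exact regular_initialState hM₀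
  | fire o _ hk hfit ih => exact ih.fire hk hfit

end Regular

/-! ### Occurrences without causal successors -/

section Undoable

variable {P T A V : Type*} {N : MRPN P T A V} {M₀ : Marking P A V} {s : State P T A V}
  {o p : N.Occurrence}

variable (M₀ s o) in
/-- The occurrence `o` has no causal successors in the regular state `s`: all that it has put into
its places is still there, and what it has taken from them has not come back by other means. -/
structure Undoable : Prop where
  occurs : o.key ∈ s.H o.t
  regular : N.Regular M₀ s
  regular_unfire : N.Regular M₀ (o.unfire s)
  newPart_subset : ∀ x, o.newPart x ⊆ s.M x
  newPart_closed : ∀ x, ClosedIn (o.newPart x) (s.M x)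
  notMem_before : ∀ x, ∀ e ∈ s.M x \ o.newPart x, ∀ a ∈ e.ends, Item.tok a ∉ o.before
  mem_newPart : ∀ x a, Item.tok a ∈ s.M x → o.key ∈ a.keys → Item.tok a ∈ o.newPart x

namespace Occurrence

theorem key_mem_keys_of_mem_newPart {x : P} {e : Item (TokenInst A V)} (he : e ∈ o.newPart x)
    {a : TokenInst A V} (ha : a ∈ e.ends) : o.key ∈ a.keys :=
  key_mem_keys_of_newPart (o.isGraph_newPart x e he a ha)

theorem mem_before_of_mem_inPart {x : P} {e : Item (TokenInst A V)} (he : e ∈ o.inPart x)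
    {a : TokenInst A V} (ha : a ∈ e.ends) : Item.tok a ∈ o.before :=
  reach_subset _ _ (o.isGraph_inPart x e he a ha)

theorem notMem_keys_of_mem_newPart {k : ℕ} (hk : k ≠ o.key)
    (hbefore : ∀ a, Item.tok a ∈ o.before → k ∉ a.keys) {x : P} {e : Item (TokenInst A V)}
    (he : e ∈ o.newPart x) {a : TokenInst A V} (ha : a ∈ e.ends) : k ∉ a.keys := by
  obtain ⟨b, -, hb, rfl⟩ := tok_mem_newPart (o.isGraph_newPart x e he a ha)
  exact fun h => (TokenInst.mem_keys_step.1 h).elim hk (hbefore b hb)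

theorem notMem_newPart_of_mem_inPart
    (hbefore : ∀ a, Item.tok a ∈ o.before → p.key ∉ a.keys) {x : P} {e : Item (TokenInst A V)}
    (he : e ∈ o.inPart x) : e ∉ p.newPart x := by
  intro hnew
  obtain ⟨a, ha⟩ := e.ends_nonempty
  exact hbefore a (mem_before_of_mem_inPart he ha) (key_mem_keys_of_mem_newPart hnew ha)

end Occurrence

theorem Regular.unfire_fire (hs : N.Regular M₀ s) (hk : ∀ t l, l ∈ s.H t → l < o.key)
    (hfit : o.Fits s.M) : o.unfire (o.fire s) = s := by
  ext x e
  · have hnew : e ∈ s.M x → e ∉ o.newPart x := by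
      intro he he'
      obtain ⟨a, ha⟩ := e.ends_nonempty
      exact hs.key_notMem hk (hs.graph x e he a ha) (Occurrence.key_mem_keys_of_mem_newPart he' ha)
    have hold : e ∈ o.inPart x → e ∈ s.M x := fun h => hfit.inPart_subset x h
    simp only [Occurrence.unfire, Occurrence.fire, Set.mem_union, Set.mem_sdiff]
    tauto
  · have hnew : e ∈ s.H x → ¬ (x = o.t ∧ e = o.key) := by
      rintro he ⟨-, rfl⟩
      exact lt_irrefl _ (hk x _ he)
    change (_ ∨ _) ∧ _ ↔ _
    tauto

theorem Regular.undoable_fire (hs : N.Regular M₀ s) (hk : ∀ t l, l ∈ s.H t → l < o.key)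
    (hfit : o.Fits s.M) : Undoable M₀ (o.fire s) o where
  occurs := Or.inr ⟨rfl, rfl⟩
  regular := hs.fire hk hfit
  regular_unfire := by rwa [hs.unfire_fire hk hfit]
  newPart_subset _ := Set.subset_union_right
  newPart_closed x := by
    rintro e (he | he) a ha hax
    · exact (hs.key_notMem hk (hs.graph x e he.1 a ha)
        (Occurrence.key_mem_keys_of_newPart hax)).elim
    · exact he
  notMem_before := by
    rintro x e ⟨he | he, hnew⟩ a ha
    · exact hfit.notMem_before hs.toDisjointGraphs he ha
    · exact (hnew he).elim
  mem_newPart := by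
    rintro x a (ha | ha) hka
    · exact (hs.key_notMem hk ha.1 hka).elim
    · exact ha

namespace Undoable

theorem notMem_inPart_of_mem_inPart (h : Undoable M₀ s p) (hfit : o.Fits s.M)
    (hbefore : ∀ a, Item.tok a ∈ o.before → p.key ∉ a.keys) {x : P} {e : Item (TokenInst A V)}
    (he : e ∈ p.inPart x) : e ∉ o.inPart x := by
  intro he'
  obtain ⟨a, ha⟩ := e.ends_nonempty
  exact h.notMem_before x e ⟨hfit.inPart_subset x he',
    Occurrence.notMem_newPart_of_mem_inPart hbefore he'⟩ a ha
    (Occurrence.mem_before_of_mem_inPart he ha)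

theorem fits_unfire (h : Undoable M₀ s p) (hfit : o.Fits s.M)
    (hbefore : ∀ a, Item.tok a ∈ o.before → p.key ∉ a.keys) : o.Fits (p.unfire s).M where
  inPart_subset x _ he :=
    Or.inl ⟨hfit.inPart_subset x he, Occurrence.notMem_newPart_of_mem_inPart hbefore he⟩
  closed := by
    rintro x e (he | he) a ha haW
    · exact hfit.closed x e he.1 a ha haW
    · obtain ⟨y, hy, hyM⟩ := hfit.exists_mem haW
      exact (h.notMem_before y _ ⟨hyM, Occurrence.notMem_newPart_of_mem_inPart hbefore hy⟩ a rfl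
        (Occurrence.mem_before_of_mem_inPart he ha)).elim

theorem unfire_fire_comm (h : Undoable M₀ s p) (hk : p.key ≠ o.key) (hfit : o.Fits s.M)
    (hbefore : ∀ a, Item.tok a ∈ o.before → p.key ∉ a.keys) :
    p.unfire (o.fire s) = o.fire (p.unfire s) := by
  ext x e
  · have hnew : e ∈ o.newPart x → e ∉ p.newPart x := by
      intro he he'
      obtain ⟨a, ha⟩ := e.ends_nonempty
      exact Occurrence.notMem_keys_of_mem_newPart hk hbefore he ha
        (Occurrence.key_mem_keys_of_mem_newPart he' ha)
    have hold : e ∈ p.inPart x → e ∉ o.inPart x := h.notMem_inPart_of_mem_inPart hfit hbefore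
    simp only [Occurrence.unfire, Occurrence.fire, Set.mem_union, Set.mem_sdiff]
    tauto
  · have hne : (x = o.t ∧ e = o.key) → ¬ (x = p.t ∧ e = p.key) := fun h h' =>
      hk (h'.2.symm.trans h.2)
    change (_ ∨ _) ∧ _ ↔ (_ ∧ _) ∨ _
    tauto

theorem fire (h : Undoable M₀ s p) (hk : ∀ t l, l ∈ s.H t → l < o.key) (hfit : o.Fits s.M)
    (hbefore : ∀ a, Item.tok a ∈ o.before → p.key ∉ a.keys) : Undoable M₀ (o.fire s) p := by
  have hne : p.key ≠ o.key := (hk p.t p.key h.occurs).ne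
  have hk' : ∀ t l, l ∈ (p.unfire s).H t → l < o.key := fun t l hl => hk t l hl.1
  have hnew : ∀ {x e a}, e ∈ o.newPart x → a ∈ e.ends → p.key ∉ a.keys := fun he ha =>
    Occurrence.notMem_keys_of_mem_newPart hne hbefore he ha
  refine ⟨Or.inl h.occurs, h.regular.fire hk hfit, ?_, fun x e he => Or.inl
    ⟨h.newPart_subset x he, fun he' => Occurrence.notMem_newPart_of_mem_inPart hbefore he' he⟩,
    ?_, ?_, ?_⟩
  · rw [h.unfire_fire_comm hne hfit hbefore]
    exact h.regular_unfire.fire hk' (h.fits_unfire hfit hbefore)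
  · rintro x e (he | he) a ha hax
    · exact h.newPart_closed x e he.1 a ha hax
    · exact (hnew he ha (Occurrence.key_mem_keys_of_newPart hax)).elim
  · rintro x e ⟨he | he, henew⟩ a ha
    · exact h.notMem_before x e ⟨he.1, henew⟩ a ha
    · intro haW
      obtain ⟨y, hy⟩ := p.switch.before.cover _ haW
      exact h.regular_unfire.key_notMem hk' (Or.inr hy)
        (Occurrence.key_mem_keys_of_mem_newPart he ha)
  · rintro x a (ha | ha) hka
    · exact h.mem_newPart x a ha.1 hka
    · exact (hnew ha rfl hka).elim

end Undoable

theorem Occurrence.notMem_keys_of_mem_before {k : ℕ} (hk : k < o.key)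
    (hlast : ∀ x a, Item.tok a ∈ (o.fire s).M x → k ∈ a.keys → ∀ l ∈ a.keys, l ≤ k) :
    ∀ a, Item.tok a ∈ o.before → k ∉ a.keys := by
  intro a ha hka
  obtain ⟨x, hx⟩ := o.switch.after.cover _ (o.switch.tok_mem_after ha)
  exact (hlast x (o.extend a) (Or.inr ⟨_, hx, rfl⟩) (TokenInst.mem_keys_step.2 (Or.inr hka))
    o.key (Occurrence.key_mem_keys_extend a)).not_gt hk

/-- Later occurrences commute with an occurrence that has no causal successors, which hence can be
cancelled from the execution. -/
theorem FwdReachable.exists_undoable (hM₀ : N.IsInitialMarking M₀) (h : N.FwdReachable M₀ s)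
    {t : T} {k : ℕ} (hkt : k ∈ s.H t)
    (hlast : ∀ x a, Item.tok a ∈ s.M x → k ∈ a.keys → ∀ l ∈ a.keys, l ≤ k) :
    ∃ p : N.Occurrence, p.t = t ∧ p.key = k ∧ Undoable M₀ s p ∧
      N.FwdReachable M₀ (p.unfire s) := by
  induction h with
  | init => exact hkt.elim
  | @fire s o h hk hfit ih =>
    have hs := h.regular hM₀
    rcases hkt with hkt | ⟨rfl, rfl⟩
    · have hbefore := Occurrence.notMem_keys_of_mem_before (hk t k hkt) hlast
      obtain ⟨p, rfl, rfl, hp, hunfire⟩ := ih hkt fun x a ha hka =>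
        hlast x a (Or.inl ⟨ha, fun hin =>
          hbefore a (Occurrence.mem_before_of_mem_inPart hin rfl) hka⟩) hka
      refine ⟨p, rfl, rfl, hp.fire hk hfit hbefore, ?_⟩
      rw [hp.unfire_fire_comm (hk p.t p.key hkt).ne hfit hbefore]
      exact hunfire.fire o (fun t' l hl => hk t' l hl.1) (hp.fits_unfire hfit hbefore)
    · refine ⟨o, rfl, rfl, hs.undoable_fire hk hfit, ?_⟩
      rwa [hs.unfire_fire hk hfit]

end Undoable

/-! ### Forward steps are occurrences -/

section Forward

variable {P T A V : Type*} {N : MRPN P T A V} {M₀ : Marking P A V} {s s' : State P T A V} {t : T}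
  {k : ℕ} {U : V → TokenInst A V}

theorem isGraph_arcIn (N : MRPN P T A V) (x : P) (t : T) : IsGraph (N.arcIn x t) :=
  isGraph_iff.2 fun u v h => ⟨(N.arcIn_bond x t u v h).1, (N.arcIn_bond x t u v h).2.1⟩

theorem isGraph_arcOut (N : MRPN P T A V) (t : T) (x : P) : IsGraph (N.arcOut t x) :=
  isGraph_iff.2 fun u v h => ⟨(N.arcOut_bond t x u v h).1, (N.arcOut_bond t x u v h).2.1⟩

theorem tok_mem_pre_iff_post (hN : N.WellFormed) (a : TokenInst A V) :
    Item.tok a ∈ N.pre t U ↔ Item.tok a ∈ N.post t U :=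
  tok_mem_selected_congr (hN t).1 a

theorem WellFormed.exists_tok_arcIn (hN : N.WellFormed) {x : P} {u : V}
    (hu : Item.tok u ∈ N.arcOut t x) :
    ∃ y, Item.tok u ∈ N.arcIn y t :=
  Set.mem_iUnion.1 (((hN t).1 u).2 (Set.mem_iUnion.2 ⟨x, hu⟩))

namespace FwdAssignment

theorem map_mem_place (hU : N.FwdAssignment s t U) {x : P} {e : Item V} (he : e ∈ N.arcIn x t) :
    e.map U ∈ s.M x := by
  cases e with
  | tok u => exact (hU.2.1 x u he).1
  | bond p =>
    induction p with
    | h u v => exact hU.2.2.1 x u v he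

theorem fwdIn_eq (hU : N.FwdAssignment s t U) (hs : DisjointGraphs s.M) (x : P) :
    N.fwdIn s t U x = labelPart (fun y => N.arcIn y t) U (s.M x) x :=
  setOf_connected_eq_reach (hs.graph x) fun u hu => (hU.2.1 x u hu).1

theorem fwdIn_subset (hs : DisjointGraphs s.M) (x : P) : N.fwdIn s t U x ⊆ s.M x := by
  rintro e ⟨u, -, he⟩
  exact connected_subset (hs.graph x) _ he

theorem isGraph_iUnion_fwdIn (hU : N.FwdAssignment s t U) (hs : DisjointGraphs s.M) :
    IsGraph (⋃ y, N.fwdIn s t U y) := by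
  refine IsGraph.iUnion fun y => ?_
  rw [hU.fwdIn_eq hs]
  exact isGraph_reach (hs.graph y) _

theorem iUnion_fwdIn_closedIn (hU : N.FwdAssignment s t U) (hs : DisjointGraphs s.M) (x : P) :
    ClosedIn (⋃ y, N.fwdIn s t U y) (s.M x) := by
  intro e he a ha haW
  obtain ⟨y, hy⟩ := Set.mem_iUnion.1 haW
  obtain rfl := hs.uniq x y a (hs.graph x e he a ha) (fwdIn_subset hs y hy)
  rw [hU.fwdIn_eq hs] at hy
  exact Set.mem_iUnion.2 ⟨x, hU.fwdIn_eq hs x ▸ closedIn_reach _ _ e he a ha hy⟩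

theorem pre_subset (hU : N.FwdAssignment s t U) (hs : DisjointGraphs s.M) :
    N.pre t U ⊆ ⋃ y, N.fwdIn s t U y := by
  rintro _ ⟨e, he, rfl⟩
  obtain ⟨x, hx⟩ := Set.mem_iUnion.1 he
  exact Set.mem_iUnion.2 ⟨x, hU.fwdIn_eq hs x ▸
    map_mem_labelPart (ℓ := fun y => N.arcIn y t) (N.isGraph_arcIn x t) hx (hU.map_mem_place hx)⟩

theorem labelPart_iUnion_fwdIn (hU : N.FwdAssignment s t U) (hs : DisjointGraphs s.M) (x : P) :
    labelPart (fun y => N.arcIn y t) U (⋃ y, N.fwdIn s t U y) x = N.fwdIn s t U x := by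
  rw [hU.fwdIn_eq hs]
  ext e
  constructor
  · rintro ⟨he, _, ⟨u, hu, rfl⟩, b, hb, hub⟩
    have heM := Set.iUnion_mono (fwdIn_subset hs) he
    obtain ⟨hub, hbx⟩ := (hub.mono (Set.iUnion_mono (fwdIn_subset hs))).restrict (hs.graph x)
      (hs.closedIn x) (hU.2.1 x u hu).1
    exact ⟨hs.closedIn x e heM b hb hbx, U u, ⟨u, hu, rfl⟩, b, hb, hub⟩
  · rintro ⟨he, _, ⟨u, hu, rfl⟩, b, hb, hub⟩
    have huW := hU.pre_subset hs (map_mem_selected (ℓ := fun y => N.arcIn y t) hu)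
    obtain ⟨hub, hbW⟩ := hub.restrict (hU.isGraph_iUnion_fwdIn hs) (hU.iUnion_fwdIn_closedIn hs x)
      huW
    exact ⟨hU.iUnion_fwdIn_closedIn hs x e he b hb hbW, U u, ⟨u, hu, rfl⟩, b, hb, hub⟩

theorem labelledBy (hU : N.FwdAssignment s t U) (hs : DisjointGraphs s.M) :
    LabelledBy (fun x => N.arcIn x t) U (⋃ y, N.fwdIn s t U y) where
  label x := N.isGraph_arcIn x t
  graph := hU.isGraph_iUnion_fwdIn hs
  selected_subset := hU.pre_subset hs
  hom x y u v hu hv huv := by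
    have hvx := ((huv.mono (Set.iUnion_mono (fwdIn_subset hs))).restrict (hs.graph x)
      (hs.closedIn x) (hU.2.1 x u hu).1).2
    exact hs.uniq x y _ hvx (hU.2.1 y v hv).1
  cover e he := by
    simpa only [hU.labelPart_iUnion_fwdIn hs, Set.mem_iUnion] using he

/-- The fourth clause of `FwdAssignment` excludes that `t` creates a bond that is already there. -/
theorem inter_post_subset_pre (hU : N.FwdAssignment s t U) (hs : DisjointGraphs s.M)
    (hN : N.WellFormed) : (⋃ y, N.fwdIn s t U y) ∩ N.post t U ⊆ N.pre t U := by
  rintro (a | p) ⟨he, hpost⟩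
  · exact (tok_mem_pre_iff_post hN a).2 hpost
  · obtain ⟨x, hx⟩ := Set.mem_iUnion.1 (Set.iUnion_mono (fwdIn_subset hs) he)
    induction p with
    | h a b =>
      obtain ⟨u, v, huv, rfl, rfl⟩ := Item.bond_mem_map_image.1 hpost
      obtain ⟨w, hw⟩ := Set.mem_iUnion.1 huv
      have hends := isGraph_iff.1 (N.isGraph_arcOut t w) _ _ hw
      obtain ⟨y, hy⟩ := hN.exists_tok_arcIn hends.1
      obtain ⟨z, hz⟩ := hN.exists_tok_arcIn hends.2
      obtain rfl := hs.uniq x y _ (hs.graph x _ hx (U u) (by simp)) (hU.2.1 y u hy).1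
      obtain rfl := hs.uniq x z _ (hs.graph x _ hx (U v) (by simp)) (hU.2.1 z v hz).1
      exact map_mem_selected (ℓ := fun y => N.arcIn y t) (hU.2.2.2.1 x u v hy hz hx)

theorem localExchange (hU : N.FwdAssignment s t U) (hs : DisjointGraphs s.M) (hN : N.WellFormed) :
    LocalExchange s.M (⋃ y, N.fwdIn s t U y) (N.pre t U) (N.arcOut t) U where
  places := hs
  graph := hU.isGraph_iUnion_fwdIn hs
  subset := Set.iUnion_mono (fwdIn_subset hs)
  closed := hU.iUnion_fwdIn_closedIn hs
  label := N.isGraph_arcOut t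
  var_mem x u hu := hU.pre_subset hs ((tok_mem_pre_iff_post hN _).2 (map_mem_selected hu))
  tok_selected a := (tok_mem_pre_iff_post hN a).1
  local_hom x y z u v hu hv huz huv := by
    by_contra hxy
    obtain ⟨z', hz'⟩ := hN.exists_tok_arcIn hu
    obtain rfl := hs.uniq z z' _ huz (hU.2.1 z' u hz').1
    have hgraph : IsGraph ((s.M z \ N.pre t U) ∪ N.post t U) :=
      (hs.graph z).diff_union (isGraph_selected (N.isGraph_arcOut t))
        fun a => (tok_mem_pre_iff_post hN a).1
    refine hU.2.2.2.2 x y u v hu hv hxy z ⟨_, hz'⟩ ?_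
    rw [tok_mem_connected hgraph (Or.inr (map_mem_selected hv))]
    exact huv.symm

/-- The occurrence of `t` with key `k` that an enabling assignment gives rise to. -/
def occurrence (hU : N.FwdAssignment s t U) (hs : DisjointGraphs s.M) (hN : N.WellFormed)
    (k : ℕ) : N.Occurrence where
  t := t
  key := k
  U := U
  before := ⋃ y, N.fwdIn s t U y
  after := ((⋃ y, N.fwdIn s t U y) \ N.pre t U) ∪ N.post t U
  inj := hU.1
  switch := (hU.labelledBy hs).switch (N.isGraph_arcOut t) (hN t).1
    (hU.inter_post_subset_pre hs hN) (hU.localExchange hs hN).hom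

theorem occurrence_fits (hU : N.FwdAssignment s t U) (hs : DisjointGraphs s.M)
    (hN : N.WellFormed) (k : ℕ) : (hU.occurrence hs hN k).Fits s.M where
  inPart_subset x := (hU.labelPart_iUnion_fwdIn hs x).trans_subset (fwdIn_subset hs x)
  closed := hU.iUnion_fwdIn_closedIn hs

theorem fire_occurrence (hU : N.FwdAssignment s t U) (hs : DisjointGraphs s.M)
    (hN : N.WellFormed) (k : ℕ) :
    (hU.occurrence hs hN k).fire s =
      ⟨fun x => (s.M x \ N.fwdIn s t U x) ∪
        Item.map (fun a => TokenInst.step a k (N.varOf t U a)) '' N.fwdOut s t U x,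
        fun t' => {l | l ∈ s.H t' ∨ (t' = t ∧ l = k)}⟩ := by
  ext1
  · funext x
    have hin : (hU.occurrence hs hN k).inPart x = N.fwdIn s t U x :=
      hU.labelPart_iUnion_fwdIn hs x
    have hout : N.fwdOut s t U x = (hU.occurrence hs hN k).outPart x :=
      (hU.localExchange hs hN).setOf_local_connected_eq_labelPart x
    change _ = (s.M x \ N.fwdIn s t U x) ∪ _ '' N.fwdOut s t U x
    rw [hout, ← hin]
    rfl
  · rfl

end FwdAssignment

theorem FwdReachable.fwdStep (hM₀ : N.IsInitialMarking M₀) (hN : N.WellFormed)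
    (h : N.FwdReachable M₀ s) (hstep : N.FwdStep s t k s') : N.FwdReachable M₀ s' := by
  have hs := (h.regular hM₀).toDisjointGraphs
  obtain ⟨⟨m, hm, rfl⟩, ⟨U, hU, hM⟩, hH⟩ := hstep
  have hs' : s' = (hU.occurrence hs hN (m + 1)).fire s := by
    rw [hU.fire_occurrence hs hN]
    exact State.ext (funext hM) (funext fun t' => Set.ext (hH t'))
  rw [hs']
  exact h.fire _ (fun t' l hl => Nat.lt_succ_of_le (hm.2 (Or.inr ⟨t', hl⟩)))
    (hU.occurrence_fits hs hN _)

end Forward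

/-! ### Causal-order reversal undoes an occurrence -/

section Reversal

variable {P T A V : Type*} {N : MRPN P T A V} {M₀ : Marking P A V} {s : State P T A V}
  {o : N.Occurrence} {t : T} {k : ℕ} {U U' : V → TokenInst A V}

namespace Occurrence

variable (o U') in
/-- `U'` assigns to each variable of the transition the token into which the occurrence `o` has
turned the token that it selected by this variable. -/
def Selects : Prop := ∀ u, Item.tok u ∈ N.guard o.t → U' u = o.extend (o.U u)

theorem Selects.switch (h : o.Selects U') :
    Switch (fun x => N.arcIn x o.t) (N.arcOut o.t) U' (Item.map o.extend '' o.before)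
      (Item.map o.extend '' o.after) :=
  (o.switch.map extend_injective).congr fun u hu => (h u hu).symm

theorem Selects.map_image_inPart (h : o.Selects U') (x : P) :
    Item.map o.extend '' o.inPart x =
      labelPart (fun y => N.arcIn y o.t) U' (Item.map o.extend '' o.before) x := by
  rw [inPart, o.switch.before.map_image_labelPart extend_injective.injOn]
  exact labelPart_congr (fun u hu => (h u (Set.mem_iUnion.2 ⟨x, hu⟩)).symm) _

theorem Selects.newPart_eq (h : o.Selects U') (x : P) :
    o.newPart x = labelPart (N.arcOut o.t) U' (Item.map o.extend '' o.after) x := by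
  rw [newPart, outPart, o.switch.after.map_image_labelPart extend_injective.injOn]
  exact labelPart_congr (fun u hu =>
    (h u ((o.switch.vars u).2 (Set.mem_iUnion.2 ⟨x, hu⟩))).symm) _

theorem newPart_subset_after (o : N.Occurrence) (x : P) :
    o.newPart x ⊆ Item.map o.extend '' o.after := Set.image_mono (reach_subset _ _)

theorem setOf_extend_mem_eq (o : N.Occurrence) (E : Set (Item (TokenInst A V))) :
    {e | ∃ a u, e = Item.tok a ∧ Item.tok (TokenInst.step a o.key u) ∈ Item.map o.extend '' E} ∪
      {e | ∃ a b u v, e = Item.bond s(a, b) ∧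
        Item.bond s(TokenInst.step a o.key u, TokenInst.step b o.key v) ∈
          Item.map o.extend '' E} = E := by
  ext e
  constructor
  · rintro (⟨a, u, rfl, ha⟩ | ⟨a, b, u, v, rfl, hab⟩)
    · obtain ⟨c, hc, hca⟩ := Item.tok_mem_map_image.1 ha
      rwa [← (TokenInst.step.inj hca).1]
    · obtain ⟨c, d, hcd, hca, hdb⟩ := Item.bond_mem_map_image.1 hab
      rwa [← (TokenInst.step.inj hca).1, ← (TokenInst.step.inj hdb).1]
  · intro he
    cases e with
    | tok a => exact Or.inl ⟨a, _, rfl, _, he, rfl⟩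
    | bond p =>
      induction p with
      | h a b => exact Or.inr ⟨a, b, _, _, rfl, _, he, rfl⟩

end Occurrence

namespace Undoable

theorem mem_newPart_of_tok_mem_after (h : Undoable M₀ s o) {x : P} {e : Item (TokenInst A V)}
    (he : e ∈ s.M x) {a : TokenInst A V} (ha : a ∈ e.ends)
    (haW : Item.tok a ∈ Item.map o.extend '' o.after) : e ∈ o.newPart x := by
  have hka : o.key ∈ a.keys := by
    obtain ⟨b, -, rfl⟩ := Item.tok_mem_map_image.1 haW
    exact Occurrence.key_mem_keys_extend b
  exact h.newPart_closed x e he a ha (h.mem_newPart x a (h.regular.graph x e he a ha) hka)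

theorem after_closedIn (h : Undoable M₀ s o) (x : P) :
    ClosedIn (Item.map o.extend '' o.after) (s.M x) := fun _ he _ ha hax =>
  o.newPart_subset_after x (h.mem_newPart_of_tok_mem_after he ha hax)

theorem localExchange (h : Undoable M₀ s o) (hU : o.Selects U') :
    LocalExchange s.M (Item.map o.extend '' o.after) (N.post o.t U') (fun x => N.arcIn x o.t)
      U' where
  places := h.regular.toDisjointGraphs
  graph := hU.switch.after.graph
  subset e he := by
    obtain ⟨x, hx⟩ := hU.switch.after.cover e he
    exact Set.mem_iUnion.2 ⟨x, h.newPart_subset x (hU.newPart_eq x ▸ hx)⟩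
  closed := h.after_closedIn
  label := hU.switch.before.label
  var_mem x u hu := hU.switch.tok_mem_after (hU.switch.before.var_mem hu)
  tok_selected a := (tok_mem_selected_congr hU.switch.vars a).2
  local_hom x y z u v hu hv _ huv := by
    refine hU.switch.before.hom x y u v hu hv
      (huv.restrict hU.switch.before.graph ?_ (hU.switch.before.var_mem hu)).1
    rw [hU.switch.before_eq]
    rintro e (he | he) a ha haW
    · rw [← hU.switch.before_eq] at haW
      exact Or.inl ⟨h.after_closedIn z e he.1 a ha (hU.switch.tok_mem_after haW), he.2⟩
    · exact Or.inr he

theorem revIn_eq (h : Undoable M₀ s o) (hU : o.Selects U') (x : P) :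
    N.revIn s o.t U' x = o.newPart x := by
  have hvar : ∀ u, Item.tok u ∈ N.arcOut o.t x → Item.tok (U' u) ∈ o.newPart x := fun u hu =>
    hU.newPart_eq x ▸
      map_mem_labelPart (hU.switch.after.label x) hu (hU.switch.after.var_mem hu)
  have hB : ∀ a ∈ U' '' {u | Item.tok u ∈ N.arcOut o.t x}, Item.tok a ∈ o.newPart x := by
    rintro _ ⟨u, hu, rfl⟩
    exact hvar u hu
  calc N.revIn s o.t U' x
      = reach (s.M x) (U' '' {u | Item.tok u ∈ N.arcOut o.t x}) :=
        setOf_connected_eq_reach (h.regular.graph x) fun u hu => h.newPart_subset x (hvar u hu)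
    _ = reach (o.newPart x) (U' '' {u | Item.tok u ∈ N.arcOut o.t x}) :=
        reach_eq_of_closedIn (o.isGraph_newPart x) (h.newPart_subset x) (h.newPart_closed x) hB
    _ = reach (Item.map o.extend '' o.after) (U' '' {u | Item.tok u ∈ N.arcOut o.t x}) := by
        refine (reach_eq_of_closedIn (o.isGraph_newPart x) ?_ ?_ hB).symm
        · exact o.newPart_subset_after x
        · exact hU.newPart_eq x ▸ closedIn_reach _ _
    _ = o.newPart x := (hU.newPart_eq x).symm

theorem revOut_eq (h : Undoable M₀ s o) (hU : o.Selects U') (x : P) :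
    N.revOut s o.t U' x = Item.map o.extend '' o.inPart x := by
  refine ((h.localExchange hU).setOf_local_connected_eq_labelPart x).trans ?_
  rw [hU.map_image_inPart, hU.switch.before_eq]
  rfl

theorem revMarking_eq (h : Undoable M₀ s o) (hU : o.Selects U') :
    N.revMarking s o.t o.key U' = (o.unfire s).M := by
  funext x
  simp only [revMarking, h.revIn_eq hU, h.revOut_eq hU, o.setOf_extend_mem_eq,
    Occurrence.unfire]

theorem key_notMem_unfire (h : Undoable M₀ s o) {x : P} {a : TokenInst A V}
    (ha : Item.tok a ∈ (o.unfire s).M x) : o.key ∉ a.keys := by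
  intro hka
  obtain ⟨t, ht, hne⟩ := h.regular_unfire.keys x a ha o.key hka
  exact hne ⟨h.regular.hist t o.t o.key ht h.occurs, rfl⟩

theorem key_notMem_before (h : Undoable M₀ s o) {a : TokenInst A V}
    (ha : Item.tok a ∈ o.before) : o.key ∉ a.keys := by
  obtain ⟨x, hx⟩ := o.switch.before.cover _ ha
  exact h.key_notMem_unfire (x := x) (Or.inr hx)

theorem eq_extend (h : Undoable M₀ s o) {x : P} {a b : TokenInst A V} {u : V}
    (ha : Item.tok a ∈ s.M x) (hb : (TokenInst.step b o.key (some u)).EvolvesTo a) :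
    a = o.extend (o.U u) := by
  obtain ⟨c, -, hc, rfl⟩ :=
    Occurrence.tok_mem_newPart (h.mem_newPart x a ha (TokenInst.mem_keys_of_evolvesTo hb))
  rcases TokenInst.evolvesTo_step.1 hb with hb | hb
  · rw [(Occurrence.varOf_eq_some (TokenInst.step.inj hb).2.2.symm).2]
  · exact (h.key_notMem_before hc (TokenInst.mem_keys_of_evolvesTo hb)).elim

theorem selects_of_revAssignment (h : Undoable M₀ s o) (hU : N.RevAssignment s o.t o.key U) :
    o.Selects U := by
  intro u hu
  obtain ⟨x, hx⟩ := Set.mem_iUnion.1 ((o.switch.vars u).1 hu)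
  obtain ⟨⟨a, ha⟩, hux, -⟩ := hU.2.1 x u hx
  exact h.eq_extend (b := a) hux (ha ▸ .refl _)

theorem selects_of_oAssignment (h : Undoable M₀ s o) (hU : N.OAssignment s o.t o.key U) :
    o.Selects U := by
  intro u hu
  obtain ⟨⟨a, ha⟩, ⟨x, hux⟩, -⟩ := hU.2.2.1 u ((o.switch.vars u).1 hu)
  exact h.eq_extend hux ha

end Undoable

theorem CAssignment.notMem_later (hU : N.CAssignment s t k U) {u : V}
    (hu : Item.tok u ∈ N.effects t) {t' : T} {l : ℕ} (hl : l ∈ s.H t') (hkl : k < l) :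
    l ∉ (U u).keys := by
  obtain ⟨x, hx⟩ := Set.mem_iUnion.1 hu
  obtain ⟨⟨a, ha⟩, hux, -⟩ := hU.2.2.1 x u hx
  exact fun h => hU.1.2 ⟨t', l, hU.1.1, hl, hkl, x, U u, hux, ⟨a, some u, ha ▸ .refl _⟩, h⟩

theorem CAssignment.oAssignment (hN : N.WellFormed) (hU : N.CAssignment s t k U) :
    N.OAssignment s t k U := by
  refine ⟨hU.1.1, hU.2.1, fun u hu => ?_, fun u v huv => ?_, ?_, ?_⟩
  · obtain ⟨x, hx⟩ := Set.mem_iUnion.1 hu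
    obtain ⟨⟨a, ha⟩, hux, htype⟩ := hU.2.2.1 x u hx
    exact ⟨⟨a, ha ▸ .refl _⟩, ⟨x, hux⟩, htype⟩
  · obtain ⟨x, hx⟩ := Set.mem_iUnion.1 huv
    exact ⟨x, hU.2.2.2 x u v hx⟩
  · rintro u v huv - a b l u' v' hl - ⟨t', hlt', hkl, -⟩
    have hu := IsGraph.iUnion (fun x => N.isGraph_arcIn x t) _ huv u (by simp)
    exact hU.notMem_later (((hN t).1 u).1 hu) hlt' hkl (TokenInst.mem_keys_of_evolvesTo hl)
  · rintro u v huv - a b l u' v' hl - ⟨t', hlt', hkl, -⟩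
    have hu := IsGraph.iUnion (N.isGraph_arcOut t) _ huv u (by simp)
    exact hU.notMem_later hu hlt' hkl (TokenInst.mem_keys_of_evolvesTo hl)

end Reversal

/-! ### Out-of-causal-order reversal undoes an occurrence -/

section LastManipulation

variable {P T A V : Type*} {N : MRPN P T A V} {M₀ : Marking P A V} {s : State P T A V}
  {H : History T} {C : Set (Item (TokenInst A V))} {x y : P} {t : T} {l : ℕ} {L : Option (T × ℕ)}

theorem Untouched.isLastT_iff (h : Untouched M₀ x C) : IsLastT C H L ↔ L = none := by
  have hnone : ∀ t k, ¬ Manipulates C H t k := by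
    rintro t k ⟨-, a, b, u, ha, hb⟩
    exact (h.2 a ha).le (TokenInst.mem_keys_of_evolvesTo hb)
  cases L with
  | none => exact iff_of_true (fun ⟨t, k, hk⟩ => hnone t k hk) rfl
  | some L => exact iff_of_false (fun hL => hnone _ _ hL.1) (Option.some_ne_none L)

theorem PlacedBy.manipulates (h : N.PlacedBy H x C t l) : Manipulates C H t l := by
  obtain ⟨b, u, hb⟩ := h.manipulated
  exact ⟨h.occurs, _, b, u, hb, .refl _⟩

theorem PlacedBy.le_of_manipulates (h : N.PlacedBy H x C t l) {t' : T} {l' : ℕ}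
    (h' : Manipulates C H t' l') : l' ≤ l := by
  obtain ⟨-, a, b, u, ha, hb⟩ := h'
  exact h.keys_le a ha l' (TokenInst.mem_keys_of_evolvesTo hb)

theorem PlacedBy.isLastT_iff (h : N.PlacedBy H x C t l)
    (hH : ∀ t t' l, l ∈ H t → l ∈ H t' → t = t') : IsLastT C H L ↔ L = some (t, l) := by
  constructor
  · intro hL
    match L, hL with
    | none, hL => exact (hL ⟨t, l, h.manipulates⟩).elim
    | some (t', l'), hL =>
      have hl : l' = l := (h.le_of_manipulates hL.1).antisymm
        (not_lt.1 fun hlt => hL.2 ⟨t, l, hlt, h.manipulates⟩)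
      subst hl
      rw [hH t' t l' hL.1.1 h.occurs]
  · rintro rfl
    exact ⟨h.manipulates, fun ⟨_, _, hlt, h'⟩ => (h.le_of_manipulates h').not_gt hlt⟩

theorem Untouched.map_origin_eq (h : Untouched M₀ x C) (hC : IsGraph C)
    {e : Item (TokenInst A V)} (he : e ∈ C) : e.map TokenInst.origin = e :=
  Item.map_eq_self fun a ha => TokenInst.origin_eq_self (h.2 a (hC e he a ha))

theorem Untouched.isLastP_iff (h : Untouched M₀ x C) (hM₀ : N.IsInitialMarking M₀)
    (hC : IsGraph C) {a : TokenInst A V} (ha : Item.tok a ∈ C) :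
    N.IsLastP M₀ C H y ↔ y = x := by
  simp only [IsLastP, h.isLastT_iff, reduceCtorEq, false_and, exists_false, false_or, true_and]
  constructor
  · intro hy
    have hay := hy _ ha
    rw [h.map_origin_eq hC ha] at hay
    exact hM₀.2.1 y x a hay (h.1 ha)
  · rintro rfl e he
    rw [h.map_origin_eq hC he]
    exact h.1 he

theorem PlacedBy.isLastP_iff (h : N.PlacedBy H x C t l) (hN : N.WellFormed)
    (hH : ∀ t t' l, l ∈ H t → l ∈ H t' → t = t') : N.IsLastP M₀ C H y ↔ y = x := by
  have hplace : {y | ∃ a b u, Item.tok a ∈ C ∧ (TokenInst.step b l (some u)).EvolvesTo a ∧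
      Item.tok u ∈ N.arcOut t y} = {x} := by
    obtain ⟨b, u, hb⟩ := h.manipulated
    refine Set.eq_singleton_iff_unique_mem.2
      ⟨⟨_, b, u, hb, .refl _, h.place _ hb b u (.refl _)⟩, ?_⟩
    rintro z ⟨a, c, v, ha, hc, hv⟩
    by_contra hne
    exact (hN t).2 z x v hne ⟨hv, h.place a ha c v hc⟩
  simp only [IsLastP, h.isLastT_iff hH]
  constructor
  · rintro (⟨t', l', heq, hset⟩ | ⟨heq, -⟩)
    · cases heq
      exact (Set.singleton_eq_singleton_iff.1 (hplace.symm.trans hset)).symm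
    · cases heq
  · rintro rfl
    exact Or.inl ⟨t, l, rfl, hplace⟩

namespace Regular

variable {a : TokenInst A V}

theorem exists_isLastT (hs : N.Regular M₀ s) (ha : Item.tok a ∈ s.M x) :
    ∃ L, IsLastT (connected a (s.M x)) s.H L := by
  rcases hs.comp x a ha with h | ⟨t, l, h⟩
  exacts [⟨none, h.isLastT_iff.2 rfl⟩, ⟨some (t, l), (h.isLastT_iff hs.hist).2 rfl⟩]

theorem isLastP_iff (hs : N.Regular M₀ s) (hN : N.WellFormed) (hM₀ : N.IsInitialMarking M₀)
    (ha : Item.tok a ∈ s.M x) : N.IsLastP M₀ (connected a (s.M x)) s.H y ↔ y = x := by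
  rcases hs.comp x a ha with h | ⟨t, l, h⟩
  exacts [h.isLastP_iff hM₀ (isGraph_connected (hs.graph x) ha) (self_mem_connected ha),
    h.isLastP_iff hN hs.hist]

end Regular

end LastManipulation

section OutOfCausal

variable {P T A V : Type*} {N : MRPN P T A V} {M₀ : Marking P A V} {s : State P T A V}
  {o : N.Occurrence} {x y : P} {a b : TokenInst A V} {e : Item (TokenInst A V)}
  {U' : V → TokenInst A V}

namespace Occurrence

variable (o) in
open Classical in
/-- The token after the occurrence, and whatever has taken place independently of it, that
corresponds to the token `a` before it. -/
noncomputable def redo (a : TokenInst A V) : TokenInst A V :=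
  if Item.tok a ∈ o.before then o.extend a else a

theorem redo_of_mem (h : Item.tok a ∈ o.before) : o.redo a = o.extend a := if_pos h

theorem redo_of_notMem (h : Item.tok a ∉ o.before) : o.redo a = a := if_neg h

theorem map_redo_of_mem_before (he : e ∈ o.before) : e.map o.redo = e.map o.extend :=
  Item.map_congr fun a ha => redo_of_mem (o.switch.before.graph e he a ha)

theorem origin_redo (a : TokenInst A V) : (o.redo a).origin = a.origin := by
  unfold redo
  split_ifs <;> rfl

theorem forget_redo (h : o.key ∉ a.keys) : (o.redo a).forget o.key = a := by
  unfold redo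
  split_ifs
  exacts [TokenInst.forget_step h _, TokenInst.forget_eq_self h]

theorem forget_truncate_redo {l : ℕ} (h : o.key ∉ a.keys) (hl : ∀ l' ∈ a.keys, l' ≤ l) :
    ((o.redo a).truncate l).forget o.key = a := by
  by_cases ha : Item.tok a ∈ o.before ∧ ¬ o.key ≤ l
  · rw [redo_of_mem ha.1, extend, TokenInst.truncate, if_neg ha.2, TokenInst.truncate_eq_self hl,
      TokenInst.forget_eq_self h]
  · have hredo : ∀ l' ∈ (o.redo a).keys, l' ≤ l := by
      unfold redo
      split_ifs with haW
      · intro l' hl'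
        rcases TokenInst.mem_keys_step.1 hl' with rfl | hl'
        exacts [not_not.1 fun hkl => ha ⟨haW, hkl⟩, hl l' hl']
      · exact hl
    rw [TokenInst.truncate_eq_self hredo, forget_redo h]

theorem evolvesTo_redo {l : ℕ} {u : Option V} (h : l ≠ o.key) :
    (TokenInst.step b l u).EvolvesTo (o.redo a) ↔ (TokenInst.step b l u).EvolvesTo a := by
  unfold redo
  split_ifs
  · rw [extend, TokenInst.evolvesTo_step]
    simp [h]
  · rfl

variable {C : Set (Item (TokenInst A V))} {H : History T}

theorem exists_mem_map_redo {l : ℕ} (hl : l ≠ o.key) (p : V → Prop) :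
    (∃ a b u, Item.tok a ∈ Item.map o.redo '' C ∧
      (TokenInst.step b l (some u)).EvolvesTo a ∧ p u) ↔
      ∃ a b u, Item.tok a ∈ C ∧ (TokenInst.step b l (some u)).EvolvesTo a ∧ p u := by
  constructor
  · rintro ⟨_, b, u, h, hb, hu⟩
    obtain ⟨a, ha, rfl⟩ := Item.tok_mem_map_image.1 h
    exact ⟨a, b, u, ha, (evolvesTo_redo hl).1 hb, hu⟩
  · rintro ⟨a, b, u, ha, hb, hu⟩
    exact ⟨_, b, u, ⟨_, ha, rfl⟩, (evolvesTo_redo hl).2 hb, hu⟩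

theorem manipulates_map_redo (hH : ∀ t, o.key ∉ H t) {t : T} {l : ℕ} :
    Manipulates (Item.map o.redo '' C) H t l ↔ Manipulates C H t l := by
  refine and_congr_right fun hl => ?_
  simpa only [and_true] using
    exists_mem_map_redo (ne_of_mem_of_not_mem hl (hH t)) fun _ => True

theorem isLastT_map_redo (hH : ∀ t, o.key ∉ H t) {L : Option (T × ℕ)} :
    IsLastT (Item.map o.redo '' C) H L ↔ IsLastT C H L := by
  cases L <;> simp only [IsLastT, manipulates_map_redo hH]

theorem isLastP_map_redo (hH : ∀ t, o.key ∉ H t) :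
    N.IsLastP M₀ (Item.map o.redo '' C) H x ↔ N.IsLastP M₀ C H x := by
  unfold IsLastP
  simp only [isLastT_map_redo hH, Set.forall_mem_image, Item.map_map, Function.comp_def,
    origin_redo]
  refine or_congr_left (exists_congr fun t => exists_congr fun l => and_congr_right fun hL => ?_)
  simp only [exists_mem_map_redo (ne_of_mem_of_not_mem hL.1.1 (hH t))]

end Occurrence

namespace Undoable

theorem iUnion_eq (h : Undoable M₀ s o) :
    ⋃ x, s.M x = (⋃ x, s.M x \ o.newPart x) ∪ Item.map o.extend '' o.after := by
  refine Set.Subset.antisymm (Set.iUnion_subset fun x e he => ?_) (Set.union_subset ?_ ?_)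
  · by_cases hnew : e ∈ o.newPart x
    exacts [Or.inr (o.newPart_subset_after x hnew), Or.inl (Set.mem_iUnion.2 ⟨x, he, hnew⟩)]
  · exact Set.iUnion_mono fun x => Set.sdiff_subset
  · rintro _ ⟨e, he, rfl⟩
    obtain ⟨x, hx⟩ := o.switch.after.cover e he
    exact Set.mem_iUnion.2 ⟨x, h.newPart_subset x ⟨e, hx, rfl⟩⟩

theorem iUnion_unfire (s : State P T A V) (o : N.Occurrence) :
    ⋃ x, (o.unfire s).M x = (⋃ x, s.M x \ o.newPart x) ∪ o.before := by
  have hbefore : ⋃ x, o.inPart x = o.before :=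
    (Set.iUnion_subset fun _ => reach_subset _ _).antisymm fun e he =>
      Set.mem_iUnion.2 (o.switch.before.cover e he)
  rw [← hbefore, ← Set.iUnion_union_distrib]
  rfl

theorem disjoint_post (h : Undoable M₀ s o) (hU : o.Selects U') :
    Disjoint (⋃ x, s.M x \ o.newPart x) (N.post o.t U') := by
  refine Set.disjoint_left.2 fun e he hpost => ?_
  obtain ⟨x, hx⟩ := Set.mem_iUnion.1 he
  obtain ⟨a, ha⟩ := e.ends_nonempty
  have heW : e ∈ Item.map o.extend '' o.after := by
    rw [hU.switch.after_eq]
    exact Or.inr hpost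
  exact hx.2 (h.mem_newPart_of_tok_mem_after hx.1 ha (hU.switch.after.graph e heW a ha))

theorem map_redo_image_old (h : Undoable M₀ s o) :
    Item.map o.redo '' ⋃ x, s.M x \ o.newPart x = ⋃ x, s.M x \ o.newPart x := by
  refine (Set.image_congr fun e he => ?_).trans (Set.image_id _)
  obtain ⟨x, hx⟩ := Set.mem_iUnion.1 he
  exact Item.map_eq_self fun a ha => Occurrence.redo_of_notMem (h.notMem_before x e hx a ha)

theorem map_redo_iUnion_unfire (h : Undoable M₀ s o) :
    Item.map o.redo '' ⋃ x, (o.unfire s).M x =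
      (⋃ x, s.M x \ o.newPart x) ∪ Item.map o.extend '' o.before := by
  rw [iUnion_unfire, Set.image_union, h.map_redo_image_old,
    Set.image_congr fun _ => Occurrence.map_redo_of_mem_before]

theorem exchange_eq (h : Undoable M₀ s o) (hU : o.Selects U') :
    ((⋃ x, s.M x) \ N.post o.t U') ∪ N.pre o.t U' =
      Item.map o.redo '' ⋃ x, (o.unfire s).M x := by
  have hbefore : Item.map o.extend '' o.before =
      ((Item.map o.extend '' o.after) \ N.post o.t U') ∪ N.pre o.t U' := hU.switch.before_eq
  rw [h.map_redo_iUnion_unfire, hbefore, h.iUnion_eq, Set.union_sdiff_distrib,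
    (h.disjoint_post hU).sdiff_eq_left, Set.union_assoc]

theorem redo_injOn (h : Undoable M₀ s o) :
    Set.InjOn o.redo {a | Item.tok a ∈ ⋃ x, (o.unfire s).M x} := by
  intro a ha b hb hab
  obtain ⟨x, hx⟩ := Set.mem_iUnion.1 ha
  obtain ⟨y, hy⟩ := Set.mem_iUnion.1 hb
  rw [← Occurrence.forget_redo (h.key_notMem_unfire hx), hab,
    Occurrence.forget_redo (h.key_notMem_unfire hy)]

theorem component_redo (h : Undoable M₀ s o) (hU : o.Selects U')
    (ha : Item.tok a ∈ (o.unfire s).M x) :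
    N.component s o.t U' (o.redo a) = Item.map o.redo '' connected a ((o.unfire s).M x) := by
  have hr := h.regular_unfire
  have hgraph := IsGraph.iUnion hr.graph
  rw [component, setOf_mem_connected_eq_iUnion h.regular.graph, h.exchange_eq hU,
    connected_map hgraph h.redo_injOn (Set.mem_iUnion.2 ⟨x, ha⟩),
    connected_eq_of_closedIn hgraph (hr.graph x) (Set.subset_iUnion _ x) (hr.closedIn x) ha]

theorem exists_redo_eq (h : Undoable M₀ s o) (ha : Item.tok a ∈ s.M y) :
    ∃ b x, Item.tok b ∈ (o.unfire s).M x ∧ o.redo b = a := by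
  by_cases hnew : Item.tok a ∈ o.newPart y
  · obtain ⟨b, -, hb, rfl⟩ := Occurrence.tok_mem_newPart hnew
    obtain ⟨x, hx⟩ := o.switch.before.cover _ hb
    exact ⟨b, x, Or.inr hx, Occurrence.redo_of_mem hb⟩
  · exact ⟨a, y, Or.inl ⟨ha, hnew⟩,
      Occurrence.redo_of_notMem (h.notMem_before y _ ⟨ha, hnew⟩ a rfl)⟩

theorem exists_redo_mem (h : Undoable M₀ s o) (ha : Item.tok a ∈ (o.unfire s).M x) :
    ∃ y, Item.tok (o.redo a) ∈ s.M y := by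
  rcases ha with ha | ha
  · rw [Occurrence.redo_of_notMem (h.notMem_before x _ ha a rfl)]
    exact ⟨x, ha.1⟩
  · have haW : Item.tok a ∈ o.before := reach_subset _ _ ha
    obtain ⟨y, hy⟩ := o.switch.after.cover _ (o.switch.tok_mem_after haW)
    rw [Occurrence.redo_of_mem haW]
    exact ⟨y, h.newPart_subset y ⟨_, hy, rfl⟩⟩

theorem key_notMem_revHistory (h : Undoable M₀ s o) (t : T) :
    o.key ∉ revHistory s.H o.t o.key t :=
  fun hk => hk.2 ⟨h.regular.hist t o.t o.key hk.1 h.occurs, rfl⟩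

theorem lastA_redo (h : Undoable M₀ s o) (ha : Item.tok a ∈ (o.unfire s).M x)
    {L : Option (T × ℕ)}
    (hL : IsLastT (connected a ((o.unfire s).M x)) (revHistory s.H o.t o.key) L)
    (hb : Item.tok b ∈ connected a ((o.unfire s).M x)) : lastA L o.key (o.redo b) = b := by
  have hr := h.regular_unfire
  have hkey := h.key_notMem_unfire (connected_subset (hr.graph x) a hb)
  rcases hr.comp x a ha with hC | ⟨t, l, hC⟩
  · obtain rfl := hC.isLastT_iff.1 hL
    exact (Occurrence.origin_redo b).trans (TokenInst.origin_eq_self (hC.2 b hb))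
  · obtain rfl := (hC.isLastT_iff hr.hist).1 hL
    exact Occurrence.forget_truncate_redo hkey (hC.keys_le b hb)

theorem map_lastA_image_redo (h : Undoable M₀ s o) (ha : Item.tok a ∈ (o.unfire s).M x)
    {L : Option (T × ℕ)}
    (hL : IsLastT (connected a ((o.unfire s).M x)) (revHistory s.H o.t o.key) L) :
    Item.map (lastA L o.key) '' (Item.map o.redo '' connected a ((o.unfire s).M x)) =
      connected a ((o.unfire s).M x) := by
  rw [Set.image_image]
  refine (Set.image_congr fun e he => ?_).trans (Set.image_id _)
  rw [Item.map_map]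
  exact Item.map_eq_self fun b hb => h.lastA_redo ha hL
    (isGraph_connected (h.regular_unfire.graph x) ha e he b hb)

theorem oOut_eq (h : Undoable M₀ s o) (hN : N.WellFormed) (hM₀ : N.IsInitialMarking M₀)
    (hU : o.Selects U') (x : P) : N.oOut M₀ s o.t o.key U' x = (o.unfire s).M x := by
  have hr := h.regular_unfire
  have hkey := h.key_notMem_revHistory
  ext e
  constructor
  · rintro ⟨a, y, L, ha, hL, hP, he⟩
    obtain ⟨b, z, hb, rfl⟩ := h.exists_redo_eq ha
    rw [h.component_redo hU hb] at hL hP he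
    rw [Occurrence.isLastT_map_redo hkey] at hL
    obtain rfl := (hr.isLastP_iff hN hM₀ hb).1 ((Occurrence.isLastP_map_redo hkey).1 hP)
    rw [h.map_lastA_image_redo hb hL] at he
    exact connected_subset (hr.graph x) b he
  · intro he
    obtain ⟨a, ha⟩ := e.ends_nonempty
    have hax := hr.graph x e he a ha
    obtain ⟨L, hL⟩ := hr.exists_isLastT hax
    obtain ⟨y, hy⟩ := h.exists_redo_mem hax
    refine ⟨_, y, L, hy, ?_⟩
    rw [h.component_redo hU hax, Occurrence.isLastT_map_redo hkey,
      Occurrence.isLastP_map_redo hkey, h.map_lastA_image_redo hax hL]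
    exact ⟨hL, (hr.isLastP_iff hN hM₀ hax).2 rfl, mem_connected_of_mem_ends (hr.graph x) he ha⟩

theorem mem_component_of_mem_ends (h : Undoable M₀ s o) (hU : o.Selects U') (he : e ∈ s.M x)
    (hpost : e ∉ N.post o.t U') (ha : a ∈ e.ends) : e ∈ N.component s o.t U' a := by
  have hgraph : IsGraph (((⋃ x, s.M x) \ N.post o.t U') ∪ N.pre o.t U') := by
    rw [h.exchange_eq hU]
    exact (IsGraph.iUnion h.regular_unfire.graph).map _
  have heC : e ∈ ((⋃ x, s.M x) \ N.post o.t U') ∪ N.pre o.t U' :=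
    Or.inl ⟨Set.mem_iUnion.2 ⟨x, he⟩, hpost⟩
  rw [component, setOf_mem_connected_eq_iUnion h.regular.graph]
  exact mem_connected_of_mem_ends hgraph heC ha

theorem newPart_subset_oIn (h : Undoable M₀ s o) (hU : o.Selects U') (x : P) :
    o.newPart x ⊆ N.oIn M₀ s o.t o.key U' x := by
  intro e he
  by_cases hpost : e ∈ N.post o.t U'
  · exact Or.inl hpost
  obtain ⟨a, ha⟩ := e.ends_nonempty
  have hax := h.newPart_subset x (o.isGraph_newPart x e he a ha)
  have hka := Occurrence.key_mem_keys_of_mem_newPart he ha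
  refine Or.inr ⟨a, hax, h.mem_component_of_mem_ends hU (h.newPart_subset x he) hpost ha,
    Or.inr ?_⟩
  obtain ⟨b, z, hbz, rfl⟩ := h.exists_redo_eq hax
  obtain ⟨L, hL⟩ := h.regular_unfire.exists_isLastT hbz
  have hb := self_mem_connected hbz
  rw [h.component_redo hU hbz]
  refine ⟨L, (Occurrence.isLastT_map_redo h.key_notMem_revHistory).2 hL, o.redo b,
    ⟨_, hb, rfl⟩, fun hupdate => ?_⟩
  rw [h.lastA_redo hbz hL hb] at hupdate
  exact h.key_notMem_unfire hbz (hupdate ▸ hka)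

theorem oMarking_eq (h : Undoable M₀ s o) (hN : N.WellFormed) (hM₀ : N.IsInitialMarking M₀)
    (hU : o.Selects U') (x : P) :
    (s.M x \ N.oIn M₀ s o.t o.key U' x) ∪ N.oOut M₀ s o.t o.key U' x = (o.unfire s).M x := by
  rw [h.oOut_eq hN hM₀ hU]
  exact Set.union_eq_right.2 fun e he =>
    Or.inl ⟨he.1, fun hnew => he.2 (h.newPart_subset_oIn hU x hnew)⟩

end Undoable

end OutOfCausal

/-! ### Comparison of the reversals -/

section Equivalence

variable {P T A V : Type*} {N : MRPN P T A V} {M₀ : Marking P A V} {s s' : State P T A V} {t : T}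
  {k : ℕ} {U : V → TokenInst A V}

theorem CAssignment.exists_undoable (hM₀ : N.IsInitialMarking M₀) (h : N.FwdReachable M₀ s)
    (hU : N.CAssignment s t k U) :
    ∃ o : N.Occurrence, o.t = t ∧ o.key = k ∧ Undoable M₀ s o ∧ N.FwdReachable M₀ (o.unfire s) := by
  refine h.exists_undoable hM₀ hU.1.1 fun x a ha hka l hl => not_lt.1 fun hlt => hU.1.2 ?_
  obtain ⟨t', ht'⟩ := (h.regular hM₀).keys x a ha l hl
  exact ⟨t', l, hU.1.1, ht', hlt, x, a, ha, hka, hl⟩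

theorem FwdReachable.cStep (hM₀ : N.IsInitialMarking M₀) (h : N.FwdReachable M₀ s)
    (hstep : N.CStep s t k s') : N.FwdReachable M₀ s' := by
  obtain ⟨U, hU, hM, hH⟩ := hstep
  obtain ⟨o, rfl, rfl, ho, hreach⟩ := hU.exists_undoable hM₀ h
  have hs' : s' = o.unfire s :=
    State.ext (hM.trans (ho.revMarking_eq (ho.selects_of_revAssignment hU.2))) hH
  exact hs' ▸ hreach

theorem Reachable.fwdReachable (hM₀ : N.IsInitialMarking M₀) (hN : N.WellFormed)
    (h : N.Reachable M₀ s) : N.FwdReachable M₀ s := by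
  induction h with
  | refl => exact .init
  | tail _ hstep ih =>
    obtain ⟨t, k, hfwd | hc⟩ := hstep
    · exact ih.fwdStep hM₀ hN hfwd
    · exact ih.cStep hM₀ hc

theorem cStep_iff_oStep (hM₀ : N.IsInitialMarking M₀) (hN : N.WellFormed)
    (h : N.Reachable M₀ s) (hc : N.CEnabled s t k) : N.CStep s t k s' ↔ N.OStep M₀ s t k s' := by
  obtain ⟨U₁, hU₁⟩ := hc
  obtain ⟨o, rfl, rfl, ho, -⟩ := hU₁.exists_undoable hM₀ (h.fwdReachable hM₀ hN)
  constructor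
  · rintro ⟨U, hU, hM, hH⟩
    have hsel := ho.selects_of_revAssignment hU.2
    exact ⟨U, hU.oAssignment hN, fun x => by
      rw [hM, ho.revMarking_eq hsel, ho.oMarking_eq hN hM₀ hsel], hH⟩
  · rintro ⟨U, hU, hM, hH⟩
    exact ⟨U₁, hU₁, funext fun x => by
      rw [hM x, ho.oMarking_eq hN hM₀ (ho.selects_of_oAssignment hU),
        ho.revMarking_eq (ho.selects_of_revAssignment hU₁.2)], hH⟩

theorem BtAssignment.cAssignment (hU : N.BtAssignment s t k U) : N.CAssignment s t k U := by
  refine ⟨⟨hU.1.1, ?_⟩, hU.2⟩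
  rintro ⟨t', k', -, hk', hlt, -⟩
  exact hlt.not_ge (hU.1.2 t' k' hk')

theorem BtEnabled.cEnabled (h : N.BtEnabled s t k) : N.CEnabled s t k :=
  h.imp fun _ hU => hU.cAssignment

theorem BtStep.cStep (h : N.BtStep s t k s') : N.CStep s t k s' :=
  h.imp fun _ hU => ⟨hU.1.cAssignment, hU.2⟩

theorem CStep.cEnabled (h : N.CStep s t k s') : N.CEnabled s t k := h.imp fun _ hU => hU.1

theorem btStep_iff_cStep (hb : N.BtEnabled s t k) : N.BtStep s t k s' ↔ N.CStep s t k s' := by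
  refine ⟨BtStep.cStep, ?_⟩
  obtain ⟨_, hlatest, -⟩ := hb
  rintro ⟨U, hU, h⟩
  exact ⟨U, ⟨hlatest, hU.2⟩, h⟩

theorem btStep_iff_oStep (hM₀ : N.IsInitialMarking M₀) (hN : N.WellFormed)
    (h : N.Reachable M₀ s) (hb : N.BtEnabled s t k) : N.BtStep s t k s' ↔ N.OStep M₀ s t k s' :=
  (btStep_iff_cStep hb).trans (cStep_iff_oStep hM₀ hN h hb.cEnabled)

theorem btRel_subset_cRel (N : MRPN P T A V) (M₀ : Marking P A V) : N.btRel M₀ ⊆ N.cRel M₀ :=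
  fun _ hr => ⟨hr.1, hr.2.cStep⟩

theorem cRel_subset_oRel (hM₀ : N.IsInitialMarking M₀) (hN : N.WellFormed) :
    N.cRel M₀ ⊆ N.oRel M₀ :=
  fun _ hr => ⟨hr.1, (cStep_iff_oStep hM₀ hN hr.1 hr.2.cEnabled).1 hr.2⟩

end Equivalence

/-! ### The inclusions are strict -/

section Chain

/-- The net in which tokens move from place `0` to place `1` along transition `0`, and from there to
place `2` along transition `1`. -/
def chain : MRPN (Fin 3) (Fin 2) Unit Unit where
  type := id
  B := ∅
  arcIn x t := {e | x = t.castSucc ∧ e = Item.tok ()}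
  arcOut t x := {e | x = t.succ ∧ e = Item.tok ()}
  arcIn_bond := by simp
  arcOut_bond := by simp

/-- The marking of `chain` by tokens only, given by the set of tokens of each place. -/
def tokMarking (S : Fin 3 → Set (TokenInst Unit Unit)) : Marking (Fin 3) Unit Unit :=
  fun x => Item.tok '' S x

/-- The token sets after the token `a` of `S` has moved along `t` with key `k`. -/
def moveTok (S : Fin 3 → Set (TokenInst Unit Unit)) (t : Fin 2) (k : ℕ) (a : TokenInst Unit Unit) :
    Fin 3 → Set (TokenInst Unit Unit) :=
  fun x => {b | b ∈ S x ∧ ¬ (x = t.castSucc ∧ b = a)} ∪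
    {b | x = t.succ ∧ b = TokenInst.step a k (some ())}

/-- The initial token sets of the example: two tokens in place `0`. -/
def twoTok : Fin 3 → Set (TokenInst Unit Unit) :=
  fun x => {a | x = 0 ∧ (a = TokenInst.init () 0 ∨ a = TokenInst.init () 1)}

/-- The state of `chain` in which first a token has moved along transition `0`, and then the token
`a` along `t`. -/
def twoMoves (t : Fin 2) (a : TokenInst Unit Unit) : State (Fin 3) (Fin 2) Unit Unit :=
  ⟨tokMarking (moveTok (moveTok twoTok 0 1 (TokenInst.init () 0)) t 2 a),
    fun t' => {l | (t' = 0 ∧ l = 1) ∨ (t' = t ∧ l = 2)}⟩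

variable {S : Fin 3 → Set (TokenInst Unit Unit)} {H : History (Fin 2)} {t : Fin 2}
  {a : TokenInst Unit Unit}

theorem chain_wellFormed : chain.WellFormed := by
  intro t
  constructor
  · intro u
    simp [guard, effects, chain]
  · rintro x y u hxy ⟨⟨rfl, -⟩, rfl, -⟩
    exact hxy rfl

theorem twoTok_isInitialMarking : chain.IsInitialMarking (tokMarking twoTok) := by
  refine ⟨?_, ?_, ?_⟩
  · rintro x a ⟨b, ⟨-, rfl | rfl⟩, h⟩ <;> cases h <;> exact ⟨_, _, rfl⟩
  · rintro x y a ⟨b, ⟨rfl, -⟩, -⟩ ⟨c, ⟨rfl, -⟩, -⟩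
    rfl
  · rintro x a b ⟨c, -, h⟩
    cases h

theorem connected_image_tok {X : Type*} {S : Set X} {a : X} (ha : a ∈ S) :
    connected a (Item.tok '' S) = {Item.tok a} := by
  ext e
  constructor
  · rintro (⟨rfl, -⟩ | ⟨b, c, -, ⟨⟨d, -, h⟩, -⟩, -⟩)
    · rfl
    · cases h
  · rintro rfl
    exact self_mem_connected ⟨a, ha, rfl⟩

theorem chain_pre (t : Fin 2) (a : TokenInst Unit Unit) :
    chain.pre t (fun _ => a) = {Item.tok a} := by
  ext e
  simp [pre, guard, chain, eq_comm]

theorem chain_post (t : Fin 2) (a : TokenInst Unit Unit) :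
    chain.post t (fun _ => a) = {Item.tok a} := by
  ext e
  simp [post, effects, chain, eq_comm]

theorem connected_chain_exchange (S : Set (TokenInst Unit Unit)) (t : Fin 2)
    (a : TokenInst Unit Unit) :
    connected a ((Item.tok '' S \ chain.pre t fun _ => a) ∪ chain.post t fun _ => a) =
      {Item.tok a} := by
  rw [chain_pre, chain_post, Set.sdiff_union_self, Set.union_comm, Set.singleton_union,
    ← Set.image_insert_eq, connected_image_tok (Set.mem_insert _ _)]

theorem chain_varOf (t : Fin 2) (a : TokenInst Unit Unit) :
    chain.varOf t (fun _ => a) a = some () := by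
  have h : ∃ u, Item.tok u ∈ chain.guard t ∧ (fun _ : Unit => a) u = a :=
    ⟨(), Set.mem_iUnion.2 ⟨t.castSucc, rfl, rfl⟩, rfl⟩
  rw [varOf, dif_pos h]

theorem chain_fwdIn (ha : a ∈ S t.castSucc) (x : Fin 3) :
    chain.fwdIn ⟨tokMarking S, H⟩ t (fun _ => a) x = {e | x = t.castSucc ∧ e = Item.tok a} := by
  ext e
  constructor
  · rintro ⟨u, ⟨rfl, -⟩, he⟩
    exact ⟨rfl, (connected_image_tok ha).subset he⟩
  · rintro ⟨rfl, rfl⟩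
    exact ⟨(), ⟨rfl, rfl⟩, self_mem_connected ⟨a, ha, rfl⟩⟩

theorem chain_fwdOut (ha : a ∈ S t.castSucc) (x : Fin 3) :
    chain.fwdOut ⟨tokMarking S, H⟩ t (fun _ => a) x = {e | x = t.succ ∧ e = Item.tok a} := by
  ext e
  constructor
  · rintro ⟨u, y, ⟨rfl, -⟩, -, he⟩
    exact ⟨rfl, (connected_chain_exchange _ t a).subset he⟩
  · rintro ⟨rfl, rfl⟩
    exact ⟨(), t.castSucc, ⟨rfl, rfl⟩, ⟨a, ha, rfl⟩, (connected_chain_exchange _ t a).superset rfl⟩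

theorem chain_fwdAssignment (ha : a ∈ S t.castSucc) :
    chain.FwdAssignment ⟨tokMarking S, H⟩ t fun _ => a := by
  refine ⟨fun _ _ _ _ _ => rfl, ?_, ?_, ?_, ?_⟩
  · rintro x u ⟨rfl, -⟩
    exact ⟨⟨a, ha, rfl⟩, rfl⟩
  · rintro x u v ⟨-, h⟩
    cases h
  · rintro x u v - - ⟨c, -, h⟩
    cases h
  · rintro y₁ y₂ u v ⟨rfl, -⟩ ⟨rfl, -⟩ h
    exact (h rfl).elim

theorem chain_fwdStep {m : ℕ} (ha : a ∈ S t.castSucc)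
    (hm : IsGreatest ({0} ∪ {l | ∃ t', l ∈ H t'}) m) :
    chain.FwdStep ⟨tokMarking S, H⟩ t (m + 1) ⟨tokMarking (moveTok S t (m + 1) a),
      fun t' => {l | l ∈ H t' ∨ (t' = t ∧ l = m + 1)}⟩ := by
  refine ⟨⟨m, hm, rfl⟩, ⟨fun _ => a, chain_fwdAssignment ha, fun x => ?_⟩, fun _ _ => Iff.rfl⟩
  rw [chain_fwdIn ha, chain_fwdOut ha]
  ext e
  constructor
  · rintro ⟨b, ⟨hb, hne⟩ | ⟨rfl, rfl⟩, rfl⟩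
    · exact Or.inl ⟨⟨b, hb, rfl⟩, fun h => hne ⟨h.1, Item.tok.inj h.2⟩⟩
    · exact Or.inr ⟨Item.tok a, ⟨rfl, rfl⟩, by simp only [Item.map_tok, chain_varOf]⟩
  · rintro (⟨⟨b, hb, rfl⟩, hne⟩ | ⟨_, ⟨rfl, rfl⟩, rfl⟩)
    · exact ⟨b, Or.inl ⟨hb, fun h => hne ⟨h.1, congrArg Item.tok h.2⟩⟩, rfl⟩
    · exact ⟨_, Or.inr ⟨rfl, rfl⟩, by simp only [Item.map_tok, chain_varOf]⟩

theorem twoMoves_reachable (ha : a ∈ moveTok twoTok 0 1 (TokenInst.init () 0) t.castSucc) :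
    chain.Reachable (tokMarking twoTok) (twoMoves t a) := by
  have hfirst := chain_fwdStep (S := twoTok) (H := fun _ => ∅) (t := 0) (m := 0)
    (a := TokenInst.init () 0) ⟨rfl, Or.inl rfl⟩ (by simp)
  have hsecond := chain_fwdStep (S := moveTok twoTok 0 1 (TokenInst.init () 0))
    (H := fun t' => {l | t' = 0 ∧ l = 1}) (t := t) (m := 1) ha (by
      constructor
      · exact Or.inr ⟨0, rfl, rfl⟩
      · rintro l (rfl | ⟨t', -, rfl⟩) <;> simp)
  refine Relation.ReflTransGen.tail (Relation.ReflTransGen.single ⟨0, 1, Or.inl ?_⟩)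
    ⟨t, 2, Or.inl hsecond⟩
  simpa [initialState] using hfirst

theorem chain_exists_cStep : ∃ s', chain.CStep (twoMoves 0 (TokenInst.init () 1)) 0 1 s' := by
  refine ⟨⟨_, _⟩, fun _ => TokenInst.step (TokenInst.init () 0) 1 (some ()),
    ⟨⟨Or.inl ⟨rfl, rfl⟩, ?_⟩, fun _ _ _ _ _ => rfl, ?_, ?_⟩, rfl, rfl⟩
  · rintro ⟨t', k', -, hk', hlt, x, _, ⟨a, ha, ⟨⟩⟩, h1, h2⟩
    obtain rfl : k' = 2 := by
      rcases hk' with ⟨-, rfl⟩ | ⟨-, rfl⟩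
      · omega
      · rfl
    rcases ha with ⟨⟨⟨-, rfl | rfl⟩, -⟩ | ⟨-, rfl⟩, -⟩ | ⟨-, rfl⟩ <;>
      simp [TokenInst.evolvesTo_init, TokenInst.evolvesTo_step] at h1 h2
  · rintro x u ⟨rfl, -⟩
    exact ⟨⟨_, rfl⟩, ⟨_, Or.inl ⟨Or.inr ⟨rfl, rfl⟩, fun h => absurd h.1 (by decide)⟩, rfl⟩, rfl⟩
  · rintro x u v ⟨-, h⟩
    cases h

theorem chain_not_btStep (a : TokenInst Unit Unit) (s' : State (Fin 3) (Fin 2) Unit Unit) :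
    ¬ chain.BtStep (twoMoves t a) 0 1 s' := by
  rintro ⟨U, ⟨⟨-, h⟩, -⟩, -⟩
  exact absurd (h t 2 (Or.inr ⟨rfl, rfl⟩)) (by omega)

theorem chain_exists_oStep : ∃ s', chain.OStep (tokMarking twoTok)
    (twoMoves 1 (TokenInst.step (TokenInst.init () 0) 1 (some ()))) 0 1 s' := by
  refine ⟨⟨_, _⟩,
    fun _ => TokenInst.step (TokenInst.step (TokenInst.init () 0) 1 (some ())) 2 (some ()),
    ⟨Or.inl ⟨rfl, rfl⟩, fun _ _ _ _ _ => rfl, ?_, ?_, ?_, ?_⟩, fun _ => rfl, rfl⟩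
  · intro u _
    exact ⟨⟨_, .step _ _ (.refl _)⟩, ⟨2, _, Or.inr ⟨rfl, rfl⟩, rfl⟩, rfl⟩
  all_goals
    intro u v huv
    obtain ⟨x, -, h⟩ := Set.mem_iUnion.1 huv
    cases h

theorem chain_not_cStep (s' : State (Fin 3) (Fin 2) Unit Unit) :
    ¬ chain.CStep (twoMoves 1 (TokenInst.step (TokenInst.init () 0) 1 (some ()))) 0 1 s' := by
  rintro ⟨U, ⟨⟨-, h⟩, -⟩, -⟩
  exact h ⟨1, 2, Or.inl ⟨rfl, rfl⟩, Or.inr ⟨rfl, rfl⟩, by omega, 2, _,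
    ⟨_, Or.inr ⟨rfl, rfl⟩, rfl⟩, ⟨_, _, .step _ _ (.refl _)⟩, ⟨_, _, .refl _⟩⟩

theorem chain_btRel_ssubset_cRel :
    chain.btRel (tokMarking twoTok) ⊂ chain.cRel (tokMarking twoTok) := by
  refine ⟨btRel_subset_cRel _ _, fun h => ?_⟩
  obtain ⟨s', hs'⟩ := chain_exists_cStep
  have hr : chain.Reachable (tokMarking twoTok) (twoMoves 0 (TokenInst.init () 1)) :=
    twoMoves_reachable (Or.inl ⟨⟨rfl, Or.inr rfl⟩, by simp⟩)
  exact chain_not_btStep _ s' (h (a := (_, (0, 1), s')) ⟨hr, hs'⟩).2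

theorem chain_cRel_ssubset_oRel :
    chain.cRel (tokMarking twoTok) ⊂ chain.oRel (tokMarking twoTok) := by
  refine ⟨cRel_subset_oRel twoTok_isInitialMarking chain_wellFormed, fun h => ?_⟩
  obtain ⟨s', hs'⟩ := chain_exists_oStep
  have hr : chain.Reachable (tokMarking twoTok)
      (twoMoves 1 (TokenInst.step (TokenInst.init () 0) 1 (some ()))) :=
    twoMoves_reachable (Or.inr ⟨rfl, rfl⟩)
  exact chain_not_cStep s' (h (a := (_, (0, 1), s')) ⟨hr, hs'⟩).2

end Chain

end MRPN

theorem mainTheorem11_general :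
    (∀ (P : Type*) (T : Type*) (A : Type*) (V : Type*)
      (N : MRPN P T A V) (M₀ : MRPN.Marking P A V),
      N.WellFormed → N.IsInitialMarking M₀ →
      (∀ s, N.Reachable M₀ s → ∀ t k, N.CEnabled s t k →
        ∀ s', N.CStep s t k s' ↔ N.OStep M₀ s t k s') ∧
      (∀ s, N.Reachable M₀ s → ∀ t k, N.BtEnabled s t k →
        ∀ s', N.BtStep s t k s' ↔ N.OStep M₀ s t k s') ∧
      N.btRel M₀ ⊆ N.cRel M₀ ∧ N.cRel M₀ ⊆ N.oRel M₀) ∧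
    (∃ (P T A V : Type) (_ : Finite P) (_ : Finite T) (_ : Finite A) (_ : Finite V)
      (N : MRPN P T A V) (M₀ : MRPN.Marking P A V),
      N.WellFormed ∧ N.IsInitialMarking M₀ ∧
      N.btRel M₀ ⊂ N.cRel M₀ ∧ N.cRel M₀ ⊂ N.oRel M₀) :=
  ⟨fun _ _ _ _ N M₀ hN hM₀ =>
    ⟨fun _ hs _ _ hc _ => MRPN.cStep_iff_oStep hM₀ hN hs hc,
      fun _ hs _ _ hb _ => MRPN.btStep_iff_oStep hM₀ hN hs hb,
      N.btRel_subset_cRel M₀, MRPN.cRel_subset_oRel hM₀ hN⟩,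
    Fin 3, Fin 2, Unit, Unit, inferInstance, inferInstance, inferInstance, inferInstance,
    MRPN.chain, MRPN.tokMarking MRPN.twoTok, MRPN.chain_wellFormed, MRPN.twoTok_isInitialMarking,
    MRPN.chain_btRel_ssubset_cRel, MRPN.chain_cRel_ssubset_oRel⟩

theorem mainTheorem11 :
    (∀ (P : Type*) (T : Type*) (A : Type*) (V : Type*) [Finite P] [Finite T] [Finite A] [Finite V]
      (N : MRPN P T A V) (M₀ : MRPN.Marking P A V),
      N.WellFormed → N.IsInitialMarking M₀ →
      (∀ s, N.Reachable M₀ s → ∀ t k, N.CEnabled s t k →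
        ∀ s', N.CStep s t k s' ↔ N.OStep M₀ s t k s') ∧
      (∀ s, N.Reachable M₀ s → ∀ t k, N.BtEnabled s t k →
        ∀ s', N.BtStep s t k s' ↔ N.OStep M₀ s t k s') ∧
      N.btRel M₀ ⊆ N.cRel M₀ ∧ N.cRel M₀ ⊆ N.oRel M₀) ∧
    (∃ (P T A V : Type) (_ : Finite P) (_ : Finite T) (_ : Finite A) (_ : Finite V)
      (N : MRPN P T A V) (M₀ : MRPN.Marking P A V),
      N.WellFormed ∧ N.IsInitialMarking M₀ ∧
      N.btRel M₀ ⊂ N.cRel M₀ ∧ N.cRel M₀ ⊂ N.oRel M₀) := by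
  obtain ⟨hincl, hstrict⟩ := mainTheorem11_general
  exact ⟨fun P T A V _ _ _ _ => hincl P T A V, hstrict⟩
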